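/- Let $\mathbb N^*=\{1,2,\dots\}$ and let $\bar{\mathbb N}^*=\mathbb N^*\cup\{\infty\}$ be its one-point compactification, with metric $d(x,y)=|x^{-1}-y^{-1}|$, $\infty^{-1}=0$. Let $\gamma:\mathbb N^*\to(0,\infty)$ with $\sum_x\gamma(x)<\infty$. Let $Y$ be the K-process with parameters $\gamma$ and $c=0$ started at $\infty$: given i.i.d. Poisson processes $N^{(x)}$, $x\in\mathbb N^*$, of rate $1$ with event times $\sigma^{(x)}_1<\sigma^{(x)}_2<\cdots$, and independent i.i.d. exponential variables $T^{(x)}_i$ of rate $1$, put $\Gamma(s)=\sum_x\gamma(x)\sum_{i=1}^{N^{(x)}_s}T^{(x)}_i$, and let $Y(t)=x$ if $\Gamma(\sigma^{(x)}_j-)\le t<\Gamma(\sigma^{(x)}_j)$ for some $j\ge1$, and $Y(t)=\infty$ if this holds for no $x\in\mathbb N^*$. Write $\mathbb E_\infty[\,\cdot\,|\gamma]$ for expectation with respect to $Y$ with $\gamma$ fixed. Let $\Pi$ be the space of càdlàg paths $[0,\infty)\to\bar{\mathbb N}^*$ and $\Pi_u$ the space of càdlàg paths $[0,u]\to\bar{\mathbb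 N}^*$. Consider functions $\Phi(t,t';\zeta)\in\mathbb R$ of $t,t'>0$ and $\zeta\in\Pi$, measurable in $\zeta$, with the following properties, for all $t,t',\theta>0$. 1. $\Phi(t,t';\zeta)$ depends only on the restriction of $\zeta$ to $[t,t+t']$, and $\Phi(t,t';\zeta)=\Phi(1,t'/t;\zeta^t)$ where $\zeta^t(s)=\zeta(ts)$. 2. There is a number $\Psi_1(\theta)$ such that $\Phi(1,\theta;\zeta)=\Psi_1(\theta)$ whenever $\zeta\equiv x$ on $[1,1+\theta]$ for some $x\in\mathbb N^*$. 3. There is a function $\Xi=\Xi_\theta$ such that, for $0<s<\theta$ and $x\in\mathbb N^*$, $\Phi(1,\theta;\zeta)=\Xi(x,s,\eta)$ whenever $\zeta\equiv x$ on $[1,1+s)$, $\zeta(1+s)\ne x$ and $\eta\in\Pi_{\theta-s}$ is the segment $\eta(r)=\zeta(1+s+r)$; moreover: (i) $\Xi(x,s,\eta)$ is bounded uniformly in $x\in\mathbb N^*$, $0<s<\theta$, $\eta\in\Pi_{\theta-s}$; (ii) $\Xi(x,s,\eta)=\Xi(y,s,\eta)$ for $x,y\in\mathbb N^*$ whenever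 $\eta$ visits neither $x$ nor $y$; (iii) for each $x\in\mathbb N^*$ the function $\eta\mapsto\Xi(x,s,\eta)$ is continuous in the sup norm at the segment $\hat\eta_{\infty,\theta-s}\equiv\infty$, uniformly in $0<s<\theta$. 4. With $\Psi_2(s,\theta)=\Xi_\theta(x,s,\hat\eta_{\infty,\theta-s})$ for $0<s<\theta$ (independent of $x\in\mathbb N^*$ by (ii)), the limits $\Psi_2(0,\theta)=\lim_{s\downarrow0}\Psi_2(s,\theta)$ and $\Psi_2(\theta,\theta)=\lim_{s\uparrow\theta}\Psi_2(s,\theta)$ exist, $\Psi_2(\cdot,\theta)$ is differentiable on $(0,\theta)$, and $\partial_s\Psi_2(\cdot,\theta)\in L_1([0,\theta],ds)$. Let $\Phi_1(t,t';\zeta)=1\{\zeta(s)=\zeta(t)\ \forall s\in[t,t+t']\}$, $\Phi_2(t,t';\zeta)=1\{\zeta(t)=\zeta(t+t')\}$, and $\Lambda_t(\theta)=\mathbb E_\infty[\Phi_1(t,\theta t;Y)|\gamma]$. Suppose that $\gamma$ is such that, for a function $\Lambda$, $\lim_{t\to0}\Lambda_t(\theta)=\Lambda(\theta)$ for every $\theta>0$.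 Then for every $\Phi$ with the properties 1-4 and every $\theta>0$, the variable $\Phi(t,\theta t;Y)$ is integrable for every $t>0$, the function $\partial_s\Psi_2(s,\theta)\Lambda(s)$ is integrable on $[0,\theta]$, and $$\lim_{t\to0}\mathbb E_\infty[\Phi(t,\theta t;Y)|\gamma]=\Psi_2(0,\theta)+[\Psi_1(\theta)-\Psi_2(\theta,\theta)]\,\Lambda(\theta)+\int_0^\theta\partial_s\Psi_2(s,\theta)\,\Lambda(s)\,ds .$$ Both $\Phi_1$ and $\Phi_2$ have the properties 1-4, with $\Psi_1\equiv1$ and $\Psi_2\equiv0$. In particular $\Phi_1$ and $\Phi_2$ have the common aging limit $\Lambda$: $\lim_{t\to0}\mathbb E_\infty[\Phi_i(t,\theta t;Y)|\gamma]=\Lambda(\theta)$ for $i=1,2$ and every $\theta>0$. -/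

import Mathlib

open MeasureTheory ProbabilityTheory Filter Topology Set
open scoped NNReal ENNReal

/-! ### State space and càdlàg paths -/

/-- The one-point compactification of `{1, 2, …}`. -/
abbrev NBar : Type := OnePoint ℕ+

/-- The Borel σ-algebra of the state space. -/
instance NBar.measurableSpace : MeasurableSpace NBar := borel NBar

/-- `x ↦ x⁻¹`, with `∞⁻¹ = 0`. -/
noncomputable def NBar.recip (x : NBar) : ℝ := x.elim 0 (fun n : ℕ+ => ((n : ℕ) : ℝ)⁻¹)

/-- The metric `d(x, y) = |x⁻¹ - y⁻¹|` on the state space. -/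
noncomputable def NBar.d (x y : NBar) : ℝ := |x.recip - y.recip|

/-- Right continuity and existence of left limits at every point of the time set `α`
(a half-line `[0, ∞)` or a compact interval). At the smallest time the condition on left limits
is void. -/
def IsCadlag {α : Type*} [TopologicalSpace α] [Preorder α] (f : α → NBar) : Prop :=
  ∀ a : α, ContinuousWithinAt f (Ici a) a ∧ ∃ l : NBar, Tendsto f (𝓝[<] a) (𝓝 l)

/-- Càdlàg paths on the time set `α`; for `α = [0, ∞)` this is the space `Π`. It carries the
σ-algebra generated by the evaluations (for `α = [0, ∞)`, the Borel σ-algebra of the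
Skorohod topology). -/
abbrev CadlagPath (α : Type*) [TopologicalSpace α] [Preorder α] : Type _ :=
  {f : α → NBar // IsCadlag f}

/-- Càdlàg paths of length `u`. -/
abbrev PathSegment (u : ℝ≥0) : Type := CadlagPath (Icc (0 : ℝ≥0) u)

theorem isCadlag_const {α : Type*} [TopologicalSpace α] [Preorder α] (x : NBar) :
    IsCadlag (fun _ : α => x) :=
  fun _ => ⟨continuousWithinAt_const, x, tendsto_const_nhds⟩

/-- The constant path. -/
def constPath {α : Type*} [TopologicalSpace α] [Preorder α] (x : NBar) : CadlagPath α :=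
  ⟨fun _ => x, isCadlag_const x⟩

theorem IsCadlag.comp_mul {f : ℝ≥0 → NBar} (hf : IsCadlag f) {t : ℝ≥0} (ht : 0 < t) :
    IsCadlag (fun s => f (t * s)) := by
  intro a
  have hc : Continuous (fun s : ℝ≥0 => t * s) := by fun_prop
  refine ⟨(hf (t * a)).1.comp hc.continuousWithinAt
    (fun s (hs : a ≤ s) => (mul_le_mul_of_nonneg_left hs bot_le : t * a ≤ t * s)), ?_⟩
  obtain ⟨l, hl⟩ := (hf (t * a)).2
  refine ⟨l, hl.comp (tendsto_nhdsWithin_iff.2 ⟨hc.continuousAt.mono_left nhdsWithin_le_nhds, ?_⟩)⟩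
  filter_upwards [self_mem_nhdsWithin] with s hs
  exact mul_lt_mul_of_pos_left hs ht

/-- The rescaled path `ζ^t(s) = ζ(t s)`, for `t > 0`. -/
def scalePath (t : ℝ≥0) (ht : 0 < t) (ζ : CadlagPath ℝ≥0) : CadlagPath ℝ≥0 :=
  ⟨fun s => ζ.1 (t * s), ζ.2.comp_mul ht⟩

/-! ### The K-process with parameters `γ` and `c = 0`, started at `∞` -/

section KConstruction

variable {Ω : Type*}

/-- All the `ξ x j` and `T x j` together form an independent family of exponential random
variables of rate `1`. The `ξ x j`, `j = 0, 1, …`, are the successive waiting times of the Poisson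
process `N^{(x)}` of rate `1`; thus the `N^{(x)}` are i.i.d. Poisson processes, independent of the
i.i.d. exponential variables `T x j`. -/
structure IsKDriving [MeasurableSpace Ω] (P : Measure Ω) (ξ T : ℕ+ → ℕ → Ω → ℝ) : Prop where
  law_wait : ∀ x j, HasLaw (ξ x j) (expMeasure 1) P
  law_hold : ∀ x j, HasLaw (T x j) (expMeasure 1) P
  indep : iIndepFun (Sum.elim (fun p : ℕ+ × ℕ => ξ p.1 p.2) (fun p : ℕ+ × ℕ => T p.1 p.2)) P

/-- The event times of `N^{(x)}`; `eventTime ξ x j` is the `(j+1)`-st event time. -/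
noncomputable def eventTime (ξ : ℕ+ → ℕ → Ω → ℝ) (x : ℕ+) (j : ℕ) (ω : Ω) : ℝ :=
  ∑ i ∈ Finset.range (j + 1), ξ x i ω

/-- `Γ(s) = ∑_x γ(x) ∑_{i ≤ N^{(x)}_s} T^{(x)}_i`: the mark of the `(j+1)`-st event of `N^{(x)}`
counts when that event has happened by time `s`. The sum of nonnegative terms is taken in
`[0, ∞]` (it is almost surely finite for summable `γ`). -/
noncomputable def kClock (γ : ℕ+ → ℝ) (ξ T : ℕ+ → ℕ → Ω → ℝ) (s : ℝ) (ω : Ω) : ℝ≥0∞ :=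
  ∑' (x : ℕ+) (j : ℕ), if eventTime ξ x j ω ≤ s then ENNReal.ofReal (γ x * T x j ω) else 0

/-- The left limit `Γ(s-)` of the nondecreasing function `Γ`. -/
noncomputable def kClockLeft (γ : ℕ+ → ℝ) (ξ T : ℕ+ → ℕ → Ω → ℝ) (s : ℝ) (ω : Ω) : ℝ≥0∞ :=
  ⨆ r : Iio s, kClock γ ξ T r ω

/-- `Γ(σ^{(x)}_j -) ≤ t < Γ(σ^{(x)}_j)` for some `j`. -/
def KAt (γ : ℕ+ → ℝ) (ξ T : ℕ+ → ℕ → Ω → ℝ) (t : ℝ≥0) (ω : Ω) (x : ℕ+) : Prop :=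
  ∃ j : ℕ, kClockLeft γ ξ T (eventTime ξ x j ω) ω ≤ (t : ℝ≥0∞) ∧
    (t : ℝ≥0∞) < kClock γ ξ T (eventTime ξ x j ω) ω

open Classical in
/-- The K(γ, 0)-process started at `∞`: `Y(t) = x` if `Γ(σ^{(x)}_j -) ≤ t < Γ(σ^{(x)}_j)` for
some `j`, and `Y(t) = ∞` if there is no such `x`. Almost surely there is at most one such `x`;
on the exceptional null event the smallest one is taken. -/
noncomputable def kState (γ : ℕ+ → ℝ) (ξ T : ℕ+ → ℕ → Ω → ℝ) (t : ℝ≥0) (ω : Ω) : NBar :=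
  if h : ∃ x : ℕ+, KAt γ ξ T t ω x then ((PNat.find h : ℕ+) : NBar) else OnePoint.infty

open Classical in
/-- The trajectory of the K(γ, 0)-process started at `∞`, as an element of the path space. It is
almost surely càdlàg; on the exceptional null event it is replaced by the constant path `∞`. -/
noncomputable def kPath (γ : ℕ+ → ℝ) (ξ T : ℕ+ → ℕ → Ω → ℝ) (ω : Ω) : CadlagPath ℝ≥0 :=
  if h : IsCadlag (fun t => kState γ ξ T t ω) then ⟨fun t => kState γ ξ T t ω, h⟩
  else constPath OnePoint.infty

end KConstruction

/-! ### Two-time observables -/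

open Classical in
/-- `Φ₁(t, t'; X) = 1{X(s) = X(t), s ∈ [t, t + t']}`. -/
noncomputable def phiOne (t t' : ℝ≥0) (ζ : CadlagPath ℝ≥0) : ℝ :=
  if ∀ s ∈ Icc t (t + t'), ζ.1 s = ζ.1 t then 1 else 0

open Classical in
/-- `Φ₂(t, t'; X) = 1{X(t) = X(t + t')}`. -/
noncomputable def phiTwo (t t' : ℝ≥0) (ζ : CadlagPath ℝ≥0) : ℝ :=
  if ζ.1 t = ζ.1 (t + t') then 1 else 0

/-- The class of two-time observables `Φ`, together with the functions `Ψ₁`, `Ξ` and `Ψ₂` attached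
to them. `Ξ θ x s η` is the value of `Φ(1, θ; ·)` on a path that sits at the finite state `x` during
`[1, 1 + s)` and follows the segment `η`, of length `θ - s` and not starting at `x`, during
`[1 + s, 1 + θ]`. `Ψ₂ s θ`, for `0 < s < θ`, is the value of `Ξ` at the segment that is
identically `∞`, and `Ψ₂ 0 θ`, `Ψ₂ θ θ` are the limits at the endpoints. -/
structure IsTwoTimeObservable (Φ : ℝ≥0 → ℝ≥0 → CadlagPath ℝ≥0 → ℝ) (Ψ₁ : ℝ≥0 → ℝ)
    (Ξ : (θ : ℝ≥0) → ℕ+ → (s : ℝ≥0) → PathSegment (θ - s) → ℝ) (Ψ₂ : ℝ → ℝ → ℝ) : Prop where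
  measurable : ∀ t t' : ℝ≥0, 0 < t → 0 < t' → Measurable (Φ t t')
  /-- `Φ(t, t'; ζ)` depends only on `ζ` restricted to `[t, t + t']`. -/
  depends : ∀ t t' : ℝ≥0, 0 < t → 0 < t' → ∀ ζ ζ' : CadlagPath ℝ≥0,
    (∀ r ∈ Icc t (t + t'), ζ.1 r = ζ'.1 r) → Φ t t' ζ = Φ t t' ζ'
  scaling : ∀ t t' : ℝ≥0, ∀ ht : 0 < t, 0 < t' → ∀ ζ : CadlagPath ℝ≥0,
    Φ t t' ζ = Φ 1 (t' / t) (scalePath t ht ζ)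
  /-- The value on a path that is constant and finite on `[1, 1 + θ]`. -/
  const : ∀ θ : ℝ≥0, 0 < θ → ∀ (x : ℕ+) (ζ : CadlagPath ℝ≥0),
    (∀ r ∈ Icc (1 : ℝ≥0) (1 + θ), ζ.1 r = (x : NBar)) → Φ 1 θ ζ = Ψ₁ θ
  /-- The value on a path that first leaves the finite state `x` at time `1 + s`. -/
  concat : ∀ θ s : ℝ≥0, 0 < s → s < θ → ∀ (x : ℕ+) (ζ : CadlagPath ℝ≥0) (η : PathSegment (θ - s)),
    (∀ r ∈ Ico (1 : ℝ≥0) (1 + s), ζ.1 r = (x : NBar)) →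
    (∀ r : Icc (0 : ℝ≥0) (θ - s), ζ.1 (1 + s + r) = η.1 r) →
    ζ.1 (1 + s) ≠ (x : NBar) → Φ 1 θ ζ = Ξ θ x s η
  bounded : ∀ θ : ℝ≥0, 0 < θ → ∃ C : ℝ, ∀ (x : ℕ+) (s : ℝ≥0), 0 < s → s < θ →
    ∀ η : PathSegment (θ - s), |Ξ θ x s η| ≤ C
  /-- `Ξ` does not distinguish between states that the segment does not visit. -/
  homogeneous : ∀ θ s : ℝ≥0, 0 < s → s < θ → ∀ (x y : ℕ+) (η : PathSegment (θ - s)),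
    (∀ r, η.1 r ≠ (x : NBar)) → (∀ r, η.1 r ≠ (y : NBar)) → Ξ θ x s η = Ξ θ y s η
  /-- Continuity in the sup norm at the segment that is identically `∞`, uniformly in `s`. -/
  continuous_infty : ∀ θ : ℝ≥0, 0 < θ → ∀ (x : ℕ+) (ε : ℝ), 0 < ε → ∃ δ : ℝ, 0 < δ ∧
    ∀ s : ℝ≥0, 0 < s → s < θ → ∀ η : PathSegment (θ - s),
      (∀ r, NBar.d (η.1 r) OnePoint.infty ≤ δ) →
        |Ξ θ x s η - Ξ θ x s (constPath OnePoint.infty)| ≤ ε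
  psi_two : ∀ θ s : ℝ≥0, 0 < s → s < θ → ∀ x : ℕ+,
    Ψ₂ s θ = Ξ θ x s (constPath OnePoint.infty)
  psi_two_zero : ∀ θ : ℝ≥0, 0 < θ →
    Tendsto (fun s : ℝ => Ψ₂ s θ) (𝓝[>] 0) (𝓝 (Ψ₂ 0 θ))
  psi_two_end : ∀ θ : ℝ≥0, 0 < θ →
    Tendsto (fun s : ℝ => Ψ₂ s θ) (𝓝[<] (θ : ℝ)) (𝓝 (Ψ₂ θ θ))
  psi_two_differentiable : ∀ θ : ℝ≥0, 0 < θ →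
    DifferentiableOn ℝ (fun s : ℝ => Ψ₂ s θ) (Ioo 0 (θ : ℝ))
  psi_two_deriv_integrable : ∀ θ : ℝ≥0, 0 < θ →
    IntervalIntegrable (deriv (fun s : ℝ => Ψ₂ s θ)) volume 0 (θ : ℝ)

/-! One variable governs `Φ(t, θt; Y)`: the remaining holding time `S` at time `t`, in units of `t`
(`relStay`). Almost surely `Y(t)` and `Y(t(1+θ))` are finite (`Config.ae_exists_inHold`), whereas
`Y` sits at `∞` at the end of a holding interval. Hence `S > 0`, `S ≠ θ` and `Φ₁(t, rt; Y) = 1{r <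
S}` almost surely, and the hypothesis on `Λ` says that the tails `P(S > r)` converge.

If `S > θ`, then `Φ = Ψ₁(θ)`. If `S < θ`, then `Φ = Ξ(x, S, η)`, where `x` is the current state and
`η` the path after the exit. As `t → 0`, the probability that by time `t(1+θ)` the path re-enters
`x` or visits one of the states `1, …, K` tends to zero (`Config.tendsto_measure_returnEvent`).
Otherwise homogeneity replaces `x` by the state `1`, `η` stays within `1/K` of `∞`, and continuity
for this single state gives `Ψ₂(S, θ)` up to a small error. Since `Ξ` is bounded, `Φ` can be
replaced in expectation by a function of `S` alone (`Config.tendsto_integral_sub`). Writing `Ψ₂(S,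
θ)` as `Ψ₂(0, θ)` plus the integral of its derivative over `r < S`, Fubini expresses the expectation
through the tails of `S`, and dominated convergence gives the limit.

Two probabilistic inputs remain. Finiteness at a fixed time: changing one mark delays the later path
by an amount whose law has a density, while holding intervals cover Lebesgue-almost every time. No
return: the wait for the next event of `N^{(x)}` is independent of the event that `t` lies in the
present holding interval, so it is below `ε` with small probability, uniformly in `t`; if it exceeds
`ε`, a return by time `u` forces `Γ(ε) ≤ u`, which is unlikely for small `u` because `Γ(ε) > 0`.

The probability is done on a canonical product space and transferred at the end through the joint
law. -/

/-! ### Deterministic properties of the clock -/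

section Clock

variable {Ω : Type*}

/-- The event time of the pair `p = (x, j)`. -/
noncomputable abbrev pairTime (ξ : ℕ+ → ℕ → Ω → ℝ) (p : ℕ+ × ℕ) (ω : Ω) : ℝ :=
  eventTime ξ p.1 p.2 ω

/-- The time at which the holding interval of the pair `p` starts. -/
noncomputable def holdStart (γ : ℕ+ → ℝ) (ξ T : ℕ+ → ℕ → Ω → ℝ) (p : ℕ+ × ℕ) (ω : Ω) : ℝ≥0∞ :=
  kClockLeft γ ξ T (pairTime ξ p ω) ω

/-- The time at which the holding interval of the pair `p` ends. -/
noncomputable def holdEnd (γ : ℕ+ → ℝ) (ξ T : ℕ+ → ℕ → Ω → ℝ) (p : ℕ+ × ℕ) (ω : Ω) : ℝ≥0∞ :=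
  kClock γ ξ T (pairTime ξ p ω) ω

/-- The time `t` lies in the holding interval of the pair `p`. -/
def InHold (γ : ℕ+ → ℝ) (ξ T : ℕ+ → ℕ → Ω → ℝ) (t : ℝ≥0) (p : ℕ+ × ℕ) (ω : Ω) : Prop :=
  holdStart γ ξ T p ω ≤ (t : ℝ≥0∞) ∧ (t : ℝ≥0∞) < holdEnd γ ξ T p ω

variable {γ : ℕ+ → ℝ} {ξ T : ℕ+ → ℕ → Ω → ℝ} {ω : Ω}

theorem kAt_iff {t : ℝ≥0} {x : ℕ+} : KAt γ ξ T t ω x ↔ ∃ j, InHold γ ξ T t (x, j) ω := Iff.rfl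

theorem kClock_eq_tsum (s : ℝ) : kClock γ ξ T s ω =
    ∑' p : ℕ+ × ℕ, if pairTime ξ p ω ≤ s then ENNReal.ofReal (γ p.1 * T p.1 p.2 ω) else 0 :=
  (ENNReal.tsum_prod (f := fun x j => if eventTime ξ x j ω ≤ s
    then ENNReal.ofReal (γ x * T x j ω) else 0)).symm

theorem kClock_mono {s s' : ℝ} (h : s ≤ s') : kClock γ ξ T s ω ≤ kClock γ ξ T s' ω := by
  simp only [kClock_eq_tsum]
  refine ENNReal.tsum_le_tsum fun p => ?_
  split_ifs with h1 h2
  · exact le_rfl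
  · exact absurd (h1.trans h) h2
  · exact bot_le
  · exact le_rfl

theorem kClock_le_kClockLeft {r s : ℝ} (h : r < s) : kClock γ ξ T r ω ≤ kClockLeft γ ξ T s ω :=
  le_iSup (fun r : Iio s => kClock γ ξ T r ω) ⟨r, h⟩

theorem kClockLeft_le_kClock (s : ℝ) : kClockLeft γ ξ T s ω ≤ kClock γ ξ T s ω :=
  iSup_le fun r => kClock_mono (le_of_lt r.2)

theorem kClockLeft_mono {s s' : ℝ} (h : s ≤ s') : kClockLeft γ ξ T s ω ≤ kClockLeft γ ξ T s' ω :=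
  iSup_le fun r => kClock_le_kClockLeft (lt_of_lt_of_le r.2 h)

theorem holdStart_le_holdEnd (p : ℕ+ × ℕ) : holdStart γ ξ T p ω ≤ holdEnd γ ξ T p ω :=
  kClockLeft_le_kClock _

theorem kClock_add_le {r s : ℝ} {p : ℕ+ × ℕ} (h : r < pairTime ξ p ω) (hs : pairTime ξ p ω ≤ s) :
    kClock γ ξ T r ω + ENNReal.ofReal (γ p.1 * T p.1 p.2 ω) ≤ kClock γ ξ T s ω := by
  simp only [kClock_eq_tsum]
  rw [← tsum_ite_eq p (fun q : ℕ+ × ℕ => ENNReal.ofReal (γ q.1 * T q.1 q.2 ω)),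
    ← ENNReal.tsum_add]
  refine ENNReal.tsum_le_tsum fun q => ?_
  by_cases hq : q = p
  · subst hq
    simp [not_le.2 h, hs]
  · simp only [hq, if_false, add_zero]
    split_ifs with h1 h2
    · exact le_rfl
    · exact absurd (h1.trans (h.le.trans hs)) h2
    · exact bot_le
    · exact le_rfl

/-- The clock jumps at least by the mark of `p`. This one-sided bound on the length of the holding
interval is all that the covering argument needs. -/
theorem holdStart_add_le (p : ℕ+ × ℕ) :
    holdStart γ ξ T p ω + ENNReal.ofReal (γ p.1 * T p.1 p.2 ω) ≤ holdEnd γ ξ T p ω := by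
  rw [holdStart, kClockLeft, ENNReal.iSup_add]
  exact iSup_le fun r => kClock_add_le r.2 le_rfl

theorem holdEnd_le_holdStart {p q : ℕ+ × ℕ} (h : pairTime ξ p ω < pairTime ξ q ω) :
    holdEnd γ ξ T p ω ≤ holdStart γ ξ T q ω :=
  kClock_le_kClockLeft h

/-- The properties of a realization that hold almost surely and survive setting one of the marks
to zero. -/
structure IsTameClock (γ : ℕ+ → ℝ) (ξ T : ℕ+ → ℕ → Ω → ℝ) (ω : Ω) : Prop where
  wait_pos : ∀ x j, 0 < ξ x j ω
  hold_nonneg : ∀ x j, 0 ≤ T x j ω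
  inj : ∀ p q, pairTime ξ p ω = pairTime ξ q ω → p = q
  finite : ∀ s, kClock γ ξ T s ω ≠ ∞
  infinite : ∀ x, ∑' j, ENNReal.ofReal (T x j ω) = ∞

/-- The properties of a realization that hold almost surely. -/
structure IsRegularClock (γ : ℕ+ → ℝ) (ξ T : ℕ+ → ℕ → Ω → ℝ) (ω : Ω) : Prop
    extends IsTameClock γ ξ T ω where
  hold_pos : ∀ x j, 0 < T x j ω
  dense : ∀ a b : ℝ, 0 ≤ a → a < b → ∃ x, a < eventTime ξ x 0 ω ∧ eventTime ξ x 0 ω < b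

theorem eventTime_lt (h : ∀ x j, 0 < ξ x j ω) (x : ℕ+) : StrictMono fun j => eventTime ξ x j ω := by
  refine strictMono_nat_of_lt_succ fun j => ?_
  simp only [eventTime]
  rw [Finset.sum_range_succ _ (j + 1)]
  linarith [h x (j + 1)]

theorem eventTime_pos (h : ∀ x j, 0 < ξ x j ω) (x : ℕ+) (j : ℕ) : 0 < eventTime ξ x j ω :=
  Finset.sum_pos (fun i _ => h x i) ⟨0, by simp⟩

/-- Event times are distinct, and holding intervals follow one another in their order. -/
theorem IsTameClock.inHold_unique (h : IsTameClock γ ξ T ω) {t : ℝ≥0} {p q : ℕ+ × ℕ}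
    (hp : InHold γ ξ T t p ω) (hq : InHold γ ξ T t q ω) : p = q := by
  rcases lt_trichotomy (pairTime ξ p ω) (pairTime ξ q ω) with h1 | h1 | h1
  · exact absurd (hp.2.trans_le ((holdEnd_le_holdStart h1).trans hq.1)) (lt_irrefl _)
  · exact h.inj p q h1
  · exact absurd (hq.2.trans_le ((holdEnd_le_holdStart h1).trans hp.1)) (lt_irrefl _)

theorem IsTameClock.sum_le_holdEnd (h : IsTameClock γ ξ T ω) (x : ℕ+) (j : ℕ) :
    ∑ i ∈ Finset.range (j + 1), ENNReal.ofReal (γ x * T x i ω) ≤ holdEnd γ ξ T (x, j) ω := by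
  induction j with
  | zero => simpa using le_trans le_add_self (holdStart_add_le (γ := γ) (T := T) (x, 0))
  | succ j ih =>
    rw [Finset.sum_range_succ]
    refine le_trans (add_le_add_left (ih.trans (holdEnd_le_holdStart
      (eventTime_lt h.wait_pos x (Nat.lt_succ_self j)))) _)
      (holdStart_add_le (γ := γ) (T := T) (x, j + 1))

theorem IsTameClock.exists_lt_holdEnd (h : IsTameClock γ ξ T ω) (hγ : ∀ x, 0 < γ x) (x : ℕ+) (t : ℝ≥0) :
    ∃ j, (t : ℝ≥0∞) < holdEnd γ ξ T (x, j) ω := by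
  have h1 : ∑' j, ENNReal.ofReal (γ x * T x j ω) = ∞ := by
    simp only [ENNReal.ofReal_mul (hγ x).le]
    rw [ENNReal.tsum_mul_left, h.infinite x, ENNReal.mul_top]
    simpa using hγ x
  have h2 := (tendsto_add_atTop_iff_nat 1).2
    (ENNReal.summable (f := fun j => ENNReal.ofReal (γ x * T x j ω))).hasSum.tendsto_sum_nat
  rw [h1] at h2
  obtain ⟨j, hj⟩ := (h2.eventually (lt_mem_nhds (ENNReal.coe_lt_top (r := t)))).exists
  exact ⟨j, hj.trans_le (h.sum_le_holdEnd x j)⟩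

/-- The marks of `x` have infinite sum, so the clock passes `t` after finitely many events of `x`.
This finiteness is what makes the path càdlàg. -/
theorem IsTameClock.finite_holdStart_le (h : IsTameClock γ ξ T ω) (hγ : ∀ x, 0 < γ x) (x : ℕ+) (t : ℝ≥0) :
    {j | holdStart γ ξ T (x, j) ω ≤ t}.Finite := by
  obtain ⟨j, hj⟩ := h.exists_lt_holdEnd hγ x t
  refine (finite_Iic j).subset fun k hk => ?_
  by_contra hjk
  exact absurd (hj.trans_le ((holdEnd_le_holdStart (eventTime_lt h.wait_pos x
    (not_le.1 hjk))).trans hk)) (lt_irrefl _)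

theorem IsTameClock.kState_eq_coe_iff (h : IsTameClock γ ξ T ω) {t : ℝ≥0} {x : ℕ+} :
    kState γ ξ T t ω = (x : NBar) ↔ ∃ j, InHold γ ξ T t (x, j) ω := by
  classical
  unfold kState
  split_ifs with h1
  · have hf := PNat.find_spec h1
    generalize PNat.find h1 = y at hf ⊢
    rw [OnePoint.coe_eq_coe]
    obtain ⟨j, hj⟩ := kAt_iff.1 hf
    constructor
    · rintro rfl
      exact ⟨j, hj⟩
    · rintro ⟨k, hk⟩
      exact congrArg Prod.fst (h.inHold_unique hj hk)
  · simp only [OnePoint.infty_ne_coe, false_iff]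
    exact fun h2 => h1 ⟨x, h2⟩

theorem kState_eq_infty_iff {t : ℝ≥0} :
    kState γ ξ T t ω = OnePoint.infty ↔ ∀ p, ¬ InHold γ ξ T t p ω := by
  unfold kState
  split_ifs with h1
  · simp only [OnePoint.coe_ne_infty, false_iff, not_forall, not_not]
    obtain ⟨x, j, hj⟩ := h1
    exact ⟨(x, j), hj⟩
  · simp only [true_iff]
    exact fun p hp => h1 ⟨p.1, p.2, hp⟩

/-- Compact sets of the discrete space `ℕ+` are finite, so leaving each point eventually is enough.
-/
theorem tendsto_nhds_infty_of {α : Type*} {l : Filter α} {f : α → NBar}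
    (h : ∀ x : ℕ+, ∀ᶠ a in l, f a ≠ (x : NBar)) : Tendsto f l (𝓝 OnePoint.infty) := by
  refine OnePoint.hasBasis_nhds_infty.tendsto_right_iff.2 fun s hs => ?_
  have hfin : s.Finite := isCompact_iff_finite.1 hs.2
  filter_upwards [(eventually_all_finite hfin).2 fun x _ => h x] with a ha
  induction hfa : f a using OnePoint.rec with
  | infty => exact Or.inr rfl
  | coe x => exact Or.inl ⟨x, fun hx => ha x hx hfa, rfl⟩

theorem IsTameClock.isCadlag_kState (h : IsTameClock γ ξ T ω) (hγ : ∀ x, 0 < γ x) :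
    IsCadlag fun t => kState γ ξ T t ω := by
  intro t
  -- Only finitely many holding intervals of `x` start by `t + 1`, so `x` is avoided near `t` once
  -- each interval is avoided separately.
  have hfin : ∀ (x : ℕ+) (l : Filter ℝ≥0), (∀ᶠ u in l, u ≤ t + 1) →
      (∀ j, ∀ᶠ u in l, ¬ InHold γ ξ T u (x, j) ω) →
      ∀ᶠ u in l, kState γ ξ T u ω ≠ (x : NBar) := by
    intro x l hl hj
    have := (eventually_all_finite (h.finite_holdStart_le hγ x (t + 1))).2 fun j _ => hj j
    filter_upwards [this, hl] with u hu hu1 hx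
    obtain ⟨j, hj⟩ := h.kState_eq_coe_iff.1 hx
    exact hu j (hj.1.trans (by exact_mod_cast hu1)) hj
  have hcoe : Continuous fun u : ℝ≥0 => (u : ℝ≥0∞) := ENNReal.continuous_coe
  constructor
  · by_cases ht : ∃ p, InHold γ ξ T t p ω
    · obtain ⟨p, hp⟩ := ht
      have hx : kState γ ξ T t ω = (p.1 : NBar) := h.kState_eq_coe_iff.2 ⟨p.2, hp⟩
      rw [ContinuousWithinAt, hx]
      refine tendsto_const_nhds.congr' ?_
      filter_upwards [self_mem_nhdsWithin, nhdsWithin_le_nhds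
        (hcoe.continuousAt.eventually_lt_const hp.2)] with u hu hu2
      exact (h.kState_eq_coe_iff.2 ⟨p.2, hp.1.trans (by exact_mod_cast hu), hu2⟩).symm
    · push Not at ht
      rw [ContinuousWithinAt, kState_eq_infty_iff.2 ht]
      refine tendsto_nhds_infty_of fun x => hfin x _ (nhdsWithin_le_nhds (eventually_le_nhds (by simp))) fun j => ?_
      have h1 := ht (x, j)
      rw [InHold, not_and_or, not_le, not_lt] at h1
      rcases h1 with h1 | h1
      · filter_upwards [nhdsWithin_le_nhds (hcoe.continuousAt.eventually_lt_const h1)] with u hu hu2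
        exact absurd (hu.trans_le hu2.1) (lt_irrefl _)
      · filter_upwards [self_mem_nhdsWithin] with u hu hu2
        exact absurd (hu2.2.trans_le (h1.trans (by exact_mod_cast hu))) (lt_irrefl _)
  · by_cases ht : ∃ p, holdStart γ ξ T p ω < t ∧ (t : ℝ≥0∞) ≤ holdEnd γ ξ T p ω
    · obtain ⟨p, hp⟩ := ht
      refine ⟨(p.1 : NBar), tendsto_const_nhds.congr' ?_⟩
      filter_upwards [self_mem_nhdsWithin, nhdsWithin_le_nhds
        (hcoe.continuousAt.eventually_const_lt hp.1)] with u hu hu2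
      exact (h.kState_eq_coe_iff.2 ⟨p.2, hu2.le, lt_of_lt_of_le (by exact_mod_cast hu) hp.2⟩).symm
    · push Not at ht
      refine ⟨OnePoint.infty, tendsto_nhds_infty_of fun x => hfin x _ ?_ fun j => ?_⟩
      · filter_upwards [self_mem_nhdsWithin] with u hu
        exact (le_of_lt hu).trans (by simp)
      · by_cases h1 : holdStart γ ξ T (x, j) ω < t
        · filter_upwards [nhdsWithin_le_nhds (hcoe.continuousAt.eventually_const_lt (ht _ h1))]
            with u hu hu2
          exact absurd (hu2.2.trans hu) (lt_irrefl _)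
        · filter_upwards [self_mem_nhdsWithin] with u hu hu2
          refine h1 (hu2.1.trans_lt (by exact_mod_cast hu))

theorem IsTameClock.kPath_apply (h : IsTameClock γ ξ T ω) (hγ : ∀ x, 0 < γ x) (t : ℝ≥0) :
    (kPath γ ξ T ω).1 t = kState γ ξ T t ω := by
  rw [kPath, dif_pos (h.isCadlag_kState hγ)]

/-- The holding intervals cover almost all of `[0, ∞)`. -/
theorem IsTameClock.ae_exists_inHold (h : IsTameClock γ ξ T ω) (hγ : ∀ x, 0 < γ x) :
    ∀ᵐ t : ℝ, 0 ≤ t → ∃ p, InHold γ ξ T t.toNNReal p ω := by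
  -- The intervals of the events up to `s` are disjoint, lie in `[0, Γ(s))` and have total length at
  -- least `Γ(s)`, so what they miss is null.
  have key : ∀ s : ℝ, volume (Ico 0 (kClock γ ξ T s ω).toReal \
      {t | ∃ p, InHold γ ξ T t.toNNReal p ω}) = 0 := by
    intro s
    set J : ℕ+ × ℕ → Set ℝ := fun p => if pairTime ξ p ω ≤ s then
      Ico (holdStart γ ξ T p ω).toReal (holdEnd γ ξ T p ω).toReal else ∅ with hJ
    have hEnd : ∀ p, holdEnd γ ξ T p ω ≠ ∞ := fun p => h.finite _
    have hStart : ∀ p, holdStart γ ξ T p ω ≠ ∞ :=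
      fun p => ne_top_of_le_ne_top (hEnd p) (holdStart_le_holdEnd p)
    have hmem : ∀ p t, t ∈ J p → 0 ≤ t ∧ InHold γ ξ T t.toNNReal p ω ∧ pairTime ξ p ω ≤ s := by
      intro p t ht
      simp only [hJ] at ht
      split_ifs at ht with hp
      · have h0 : 0 ≤ t := ENNReal.toReal_nonneg.trans ht.1
        exact ⟨h0, ⟨(ENNReal.le_ofReal_iff_toReal_le (hStart p) h0).2 ht.1,
          (ENNReal.ofReal_lt_iff_lt_toReal h0 (hEnd p)).2 ht.2⟩, hp⟩
      · exact absurd ht (notMem_empty t)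
    have hsub : (⋃ p, J p) ⊆ Ico 0 (kClock γ ξ T s ω).toReal := by
      intro t ht
      obtain ⟨p, hp⟩ := mem_iUnion.1 ht
      obtain ⟨h0, h1, h2⟩ := hmem p t hp
      exact ⟨h0, (ENNReal.ofReal_lt_iff_lt_toReal h0 (h.finite s)).1
        (h1.2.trans_le (kClock_mono h2))⟩
    have hmeas : ∀ p, MeasurableSet (J p) := by
      intro p
      simp only [hJ]
      split_ifs
      · exact measurableSet_Ico
      · exact MeasurableSet.empty
    have hvol : volume (Ico 0 (kClock γ ξ T s ω).toReal) ≤ volume (⋃ p, J p) := by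
      rw [measure_iUnion (fun p q hpq => disjoint_left.2 fun t h1 h2 => hpq
        (h.inHold_unique (hmem p t h1).2.1 (hmem q t h2).2.1)) hmeas, Real.volume_Ico, sub_zero,
        ENNReal.ofReal_toReal (h.finite s), kClock_eq_tsum]
      refine ENNReal.tsum_le_tsum fun p => ?_
      simp only [hJ]
      split_ifs
      · rw [Real.volume_Ico, ← ENNReal.toReal_sub_of_le (holdStart_le_holdEnd p) (hEnd p),
          ENNReal.ofReal_toReal (ENNReal.sub_ne_top (hEnd p))]
        exact ENNReal.le_sub_of_add_le_left (hStart p) (holdStart_add_le p)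
      · exact bot_le
    refine measure_mono_null (t := Ico 0 (kClock γ ξ T s ω).toReal \ ⋃ p, J p) ?_ ?_
    · refine sdiff_subset_sdiff_right fun t ht => ?_
      obtain ⟨p, hp⟩ := mem_iUnion.1 ht
      exact ⟨p, (hmem p t hp).2.1⟩
    · rw [measure_sdiff hsub (MeasurableSet.iUnion hmeas).nullMeasurableSet
        ((measure_mono hsub).trans_lt (by simp)).ne]
      exact tsub_eq_zero_of_le hvol
  rw [ae_iff]
  -- The clock is unbounded along the events of the state `1`, so countably many windows exhaust
  -- `[0, ∞)`.
  refine measure_mono_null ?_ (measure_iUnion_null fun j : ℕ => key (eventTime ξ 1 j ω))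
  intro t ht
  simp only [mem_ofPred_eq, Classical.not_imp] at ht
  obtain ⟨j, hj⟩ := h.exists_lt_holdEnd hγ 1 t.toNNReal
  exact mem_iUnion.2 ⟨j, ⟨ht.1, (ENNReal.ofReal_lt_iff_lt_toReal ht.1 (h.finite _)).1 hj⟩, ht.2⟩

theorem IsRegularClock.kClock_pos (h : IsRegularClock γ ξ T ω) (hγ : ∀ x, 0 < γ x) {s : ℝ} (hs : 0 < s) :
    0 < kClock γ ξ T s ω := by
  obtain ⟨y, -, h2⟩ := h.dense 0 s le_rfl hs
  refine lt_of_lt_of_le ?_ ((holdStart_add_le (y, 0)).trans (kClock_mono h2.le))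
  exact lt_of_lt_of_le (ENNReal.ofReal_pos.2 (mul_pos (hγ y) (h.hold_pos y 0))) le_add_self

/-- By density another event, with a positive mark, falls strictly between the two event times. -/
theorem IsRegularClock.holdEnd_lt_holdStart (h : IsRegularClock γ ξ T ω) (hγ : ∀ x, 0 < γ x) {p q : ℕ+ × ℕ}
    (hpq : pairTime ξ p ω < pairTime ξ q ω) : holdEnd γ ξ T p ω < holdStart γ ξ T q ω := by
  obtain ⟨y, h1, h2⟩ := h.dense _ _ (eventTime_pos h.wait_pos p.1 p.2).le hpq
  refine lt_of_lt_of_le ?_ ((kClock_add_le (p := (y, 0)) h1 le_rfl).trans (kClock_le_kClockLeft h2))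
  exact ENNReal.lt_add_right (h.finite _)
    (ENNReal.ofReal_pos.2 (mul_pos (hγ y) (h.hold_pos y 0))).ne'

theorem IsRegularClock.holdStart_pos (h : IsRegularClock γ ξ T ω) (hγ : ∀ x, 0 < γ x) (p : ℕ+ × ℕ) :
    0 < holdStart γ ξ T p ω :=
  (h.kClock_pos hγ (half_pos (eventTime_pos h.wait_pos p.1 p.2))).trans_le
    (kClock_le_kClockLeft (half_lt_self (eventTime_pos h.wait_pos p.1 p.2)))

/-- No holding interval starts at the end of another one. -/
theorem IsRegularClock.not_inHold_holdEnd (h : IsRegularClock γ ξ T ω) (hγ : ∀ x, 0 < γ x) {p : ℕ+ × ℕ}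
    {t : ℝ≥0} (ht : (t : ℝ≥0∞) = holdEnd γ ξ T p ω) (q : ℕ+ × ℕ) : ¬ InHold γ ξ T t q ω := by
  intro hq
  rw [InHold, ht] at hq
  rcases lt_trichotomy (pairTime ξ p ω) (pairTime ξ q ω) with h1 | h1 | h1
  · exact absurd ((h.holdEnd_lt_holdStart hγ h1).trans_le hq.1) (lt_irrefl _)
  · rw [h.inj p q h1] at hq
    exact lt_irrefl _ hq.2
  · exact absurd (hq.2.trans_le ((holdEnd_le_holdStart h1).trans (holdStart_le_holdEnd p)))
      (lt_irrefl _)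

end Clock

/-! ### Measurability -/

section Measurability

variable {Ω : Type*} [MeasurableSpace Ω] {γ : ℕ+ → ℝ} {ξ T : ℕ+ → ℕ → Ω → ℝ}

instance : BorelSpace NBar := ⟨rfl⟩

instance : Countable NBar := inferInstanceAs (Countable (Option ℕ+))

theorem measurable_eventTime (hξ : ∀ x j, Measurable (ξ x j)) (x : ℕ+) (j : ℕ) :
    Measurable (eventTime ξ x j) := by
  unfold eventTime
  exact Finset.measurable_sum _ fun i _ => hξ x i

theorem measurable_kClock (hξ : ∀ x j, Measurable (ξ x j)) (hT : ∀ x j, Measurable (T x j))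
    {τ : Ω → ℝ} (hτ : Measurable τ) : Measurable fun ω => kClock γ ξ T (τ ω) ω := by
  unfold kClock
  refine Measurable.tsum fun x => Measurable.tsum fun j => ?_
  exact Measurable.ite (measurableSet_le (measurable_eventTime hξ x j) hτ)
    ((hT x j).const_mul _).ennreal_ofReal measurable_const

-- Monotonicity of the clock reduces the left limit to a countable supremum, for measurability.
omit [MeasurableSpace Ω] in
theorem kClockLeft_eq_iSup_rat (s : ℝ) (ω : Ω) : kClockLeft γ ξ T s ω =
    ⨆ q : ℚ, if (q : ℝ) < s then kClock γ ξ T q ω else 0 := by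
  refine le_antisymm (iSup_le fun r => ?_) (iSup_le fun q => ?_)
  · obtain ⟨q, h1, h2⟩ := exists_rat_btwn (show (r : ℝ) < s from r.2)
    refine le_iSup_of_le q ?_
    rw [if_pos h2]
    exact kClock_mono h1.le
  · split_ifs with h
    · exact kClock_le_kClockLeft h
    · exact bot_le

theorem measurable_kClockLeft (hξ : ∀ x j, Measurable (ξ x j)) (hT : ∀ x j, Measurable (T x j))
    {τ : Ω → ℝ} (hτ : Measurable τ) : Measurable fun ω => kClockLeft γ ξ T (τ ω) ω := by
  simp only [kClockLeft_eq_iSup_rat]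
  exact Measurable.iSup fun q => Measurable.ite (measurableSet_lt measurable_const hτ)
    (measurable_kClock hξ hT measurable_const) measurable_const

theorem measurable_holdStart (hξ : ∀ x j, Measurable (ξ x j)) (hT : ∀ x j, Measurable (T x j))
    (p : ℕ+ × ℕ) : Measurable (holdStart γ ξ T p) :=
  measurable_kClockLeft hξ hT (measurable_eventTime hξ p.1 p.2)

theorem measurable_holdEnd (hξ : ∀ x j, Measurable (ξ x j)) (hT : ∀ x j, Measurable (T x j))
    (p : ℕ+ × ℕ) : Measurable (holdEnd γ ξ T p) :=
  measurable_kClock hξ hT (measurable_eventTime hξ p.1 p.2)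

theorem measurableSet_inHold (hξ : ∀ x j, Measurable (ξ x j)) (hT : ∀ x j, Measurable (T x j))
    (t : ℝ≥0) (p : ℕ+ × ℕ) : MeasurableSet {ω | InHold γ ξ T t p ω} :=
  (measurableSet_le (measurable_holdStart hξ hT p) measurable_const).inter
    (measurableSet_lt measurable_const (measurable_holdEnd hξ hT p))

theorem measurableSet_kAt (hξ : ∀ x j, Measurable (ξ x j)) (hT : ∀ x j, Measurable (T x j))
    (t : ℝ≥0) (x : ℕ+) : MeasurableSet {ω | KAt γ ξ T t ω x} := by
  simp only [kAt_iff, ofPred_exists]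
  exact MeasurableSet.iUnion fun j => measurableSet_inHold hξ hT t (x, j)

-- Valid for every `ω`, without uniqueness of the occupied state, so that measurability needs no
-- null set.
omit [MeasurableSpace Ω] in
theorem kState_eq_coe_iff_find {t : ℝ≥0} {x : ℕ+} {ω : Ω} : kState γ ξ T t ω = (x : NBar) ↔
    KAt γ ξ T t ω x ∧ ∀ y < x, ¬ KAt γ ξ T t ω y := by
  classical
  unfold kState
  split_ifs with h1
  · rw [OnePoint.coe_eq_coe, PNat.find_eq_iff]
  · simp only [OnePoint.infty_ne_coe, false_iff]
    exact fun h => h1 ⟨x, h.1⟩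

theorem measurable_kState (hξ : ∀ x j, Measurable (ξ x j)) (hT : ∀ x j, Measurable (T x j))
    (t : ℝ≥0) : Measurable (kState γ ξ T t) := by
  refine measurable_to_countable' fun x => ?_
  induction x using OnePoint.rec with
  | infty =>
    have : kState γ ξ T t ⁻¹' {OnePoint.infty} = ⋂ p, {ω | InHold γ ξ T t p ω}ᶜ := by
      ext ω
      simp [kState_eq_infty_iff]
    rw [this]
    exact MeasurableSet.iInter fun p => (measurableSet_inHold hξ hT t p).compl
  | coe x =>
    have : kState γ ξ T t ⁻¹' {(x : NBar)} = {ω | KAt γ ξ T t ω x} ∩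
        ⋂ y, ⋂ (_ : y < x), {ω | KAt γ ξ T t ω y}ᶜ := by
      ext ω
      simp [kState_eq_coe_iff_find]
    rw [this]
    exact (measurableSet_kAt hξ hT t x).inter (MeasurableSet.iInter fun y =>
      MeasurableSet.iInter fun _ => (measurableSet_kAt hξ hT t y).compl)

/-- The trajectory is a random element of the path space. -/
theorem aemeasurable_kPath (hξ : ∀ x j, Measurable (ξ x j)) (hT : ∀ x j, Measurable (T x j))
    (hγ : ∀ x, 0 < γ x) {μ : Measure Ω} (h : ∀ᵐ ω ∂μ, IsTameClock γ ξ T ω) :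
    AEMeasurable (kPath γ ξ T) μ := by
  classical
  obtain ⟨N, hN, hNm, hN0⟩ := exists_measurable_superset_of_null (ae_iff.1 h)
  have hgood : ∀ ω ∉ N, IsTameClock γ ξ T ω := fun ω hω => by_contra fun h => hω (hN h)
  -- Off the measurable null set `N` the path is given by `kState`, hence all evaluations of this
  -- modification are measurable.
  refine ⟨fun ω => if ω ∈ N then constPath OnePoint.infty else kPath γ ξ T ω, ?_, ?_⟩
  · have hval : ∀ t ω, (if ω ∈ N then constPath OnePoint.infty else kPath γ ξ T ω :
        CadlagPath ℝ≥0).1 t = if ω ∈ N then OnePoint.infty else kState γ ξ T t ω := by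
      intro t ω
      split_ifs with hω
      · rfl
      · exact (hgood ω hω).kPath_apply hγ t
    have : Measurable fun ω => (if ω ∈ N then constPath OnePoint.infty else kPath γ ξ T ω :
        CadlagPath ℝ≥0).1 := by
      refine measurable_pi_iff.2 fun t => ?_
      simp only [hval]
      exact Measurable.ite hNm measurable_const (measurable_kState hξ hT t)
    exact this.subtype_mk (h := fun ω => Subtype.prop _)
  · filter_upwards [measure_eq_zero_iff_ae_notMem.1 hN0] with ω hω
    rw [if_neg hω]

end Measurability

/-! ### Resampling one coordinate of a product measure -/

section Resampling

variable {ι : Type*} [DecidableEq ι] {X : ι → Type*} [∀ i, MeasurableSpace (X i)]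
  (μ : ∀ i, Measure (X i)) [∀ i, IsProbabilityMeasure (μ i)]

/-- Replacing one coordinate by an independent copy preserves a product law; it suffices to check
this on boxes. -/
theorem measurePreserving_update_infinitePi (i : ι) :
    MeasurePreserving (fun p : (∀ j, X j) × X i => Function.update p.1 i p.2)
      ((Measure.infinitePi μ).prod (μ i)) (Measure.infinitePi μ) := by
  have hm : Measurable fun p : (∀ j, X j) × X i => Function.update p.1 i p.2 :=
    measurable_update'
  refine ⟨hm, Measure.eq_infinitePi _ fun s t ht => ?_⟩
  rw [Measure.map_apply hm (MeasurableSet.pi s.countable_toSet fun j _ => ht j)]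
  have : (fun p : (∀ j, X j) × X i => Function.update p.1 i p.2) ⁻¹' (s : Set ι).pi t =
      ((s.erase i : Finset ι) : Set ι).pi t ×ˢ (if i ∈ s then t i else univ) := by
    ext ⟨ω, z⟩
    simp only [mem_preimage, Set.mem_pi, Finset.mem_coe, mem_prod, Finset.mem_erase]
    constructor
    · intro h
      refine ⟨fun j hj => by simpa [hj.1] using h j hj.2, ?_⟩
      split_ifs with hi
      · simpa using h i hi
      · trivial
    · rintro ⟨h1, h2⟩ j hj
      by_cases hji : j = i
      · subst hji
        simpa [hj] using h2
      · simpa [hji] using h1 j ⟨hji, hj⟩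
  rw [this, Measure.prod_prod, Measure.infinitePi_pi _ fun j _ => ht j]
  split_ifs with hi
  · exact Finset.prod_erase_mul s (fun j => μ j (t j)) hi
  · rw [Finset.erase_eq_of_notMem hi, measure_univ, mul_one]

/-- Fubini: all coordinates but `i` may be frozen, and the property checked for almost every value
of that one. -/
theorem ae_infinitePi_of_ae_update (i : ι) {A : Set (∀ j, X j)} (hA : MeasurableSet A)
    (h : ∀ᵐ ω ∂Measure.infinitePi μ, ∀ᵐ z ∂μ i, Function.update ω i z ∈ A) :
    ∀ᵐ ω ∂Measure.infinitePi μ, ω ∈ A := by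
  have hmp := measurePreserving_update_infinitePi μ i
  rw [← hmp.map_eq]
  refine (ae_map_iff (p := (· ∈ A)) hmp.measurable.aemeasurable hA).2 ?_
  exact (Measure.ae_prod_mem_iff_ae_ae_mem (hmp.measurable hA)).2 h

theorem lintegral_infinitePi_mul (i : ι) {f : X i → ℝ≥0∞} {F : (∀ j, X j) → ℝ≥0∞}
    (hf : Measurable f) (hF : Measurable F) (h : ∀ ω z, F (Function.update ω i z) = F ω) :
    ∫⁻ ω, F ω * f (ω i) ∂Measure.infinitePi μ =
      (∫⁻ ω, F ω ∂Measure.infinitePi μ) * ∫⁻ z, f z ∂μ i := by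
  have hmp := measurePreserving_update_infinitePi μ i
  rw [← hmp.lintegral_comp (by fun_prop)]
  simp only [h, Function.update_self]
  exact lintegral_prod_mul hF.aemeasurable hf.aemeasurable

end Resampling

/-! ### The exponential distribution of rate one -/

section Exponential

instance : IsProbabilityMeasure (expMeasure 1) := isProbabilityMeasure_expMeasure one_pos

theorem expMeasure_absolutelyContinuous (r : ℝ) : expMeasure r ≪ volume :=
  withDensity_absolutelyContinuous _ _

instance (r : ℝ) : NullSingletonClass (expMeasure r) :=
  ⟨fun x => expMeasure_absolutelyContinuous r (measure_singleton x)⟩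

theorem ae_expMeasure_pos : ∀ᵐ z ∂expMeasure 1, 0 < z := by
  have h := cdf_expMeasure_eq one_pos 0
  simp only [le_refl, if_true, mul_zero, neg_zero, Real.exp_zero, sub_self, cdf_eq_real] at h
  rw [measureReal_eq_zero_iff] at h
  rw [ae_iff]
  simp only [not_lt]
  exact h

theorem expMeasure_Ioc_pos {a b : ℝ} (ha : 0 ≤ a) (hab : a < b) : 0 < expMeasure 1 (Ioc a b) := by
  rw [← measure_cdf (expMeasure 1), StieltjesFunction.measure_Ioc, ENNReal.ofReal_pos,
    cdf_expMeasure_eq one_pos, cdf_expMeasure_eq one_pos, if_pos ha, if_pos (ha.trans hab.le)]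
  have : Real.exp (-(1 * b)) < Real.exp (-(1 * a)) := Real.exp_lt_exp.2 (by linarith)
  linarith

theorem measurable_exponentialPDF (r : ℝ) : Measurable (exponentialPDF r) :=
  (measurable_exponentialPDFReal r).ennreal_ofReal

theorem lintegral_expMeasure_one (f : ℝ → ℝ≥0∞) (hf : Measurable f) :
    ∫⁻ z, f z ∂expMeasure 1 = ∫⁻ z, exponentialPDF 1 z * f z := by
  have h : expMeasure 1 = volume.withDensity (exponentialPDF 1) := rfl
  rw [h, lintegral_withDensity_eq_lintegral_mul _ (measurable_exponentialPDF 1) hf]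
  rfl

/-- The integrand `z e^{-z}` is the Gamma density of shape `2` and rate `1`. -/
theorem lintegral_id_expMeasure_one : ∫⁻ z, ENNReal.ofReal z ∂expMeasure 1 = 1 := by
  rw [lintegral_expMeasure_one _ (by fun_prop),
    ← lintegral_gammaPDF_eq_one (a := 2) (r := 1) two_pos one_pos]
  refine lintegral_congr fun z => ?_
  rw [exponentialPDF_eq, gammaPDF_eq]
  split_ifs with hz
  · rw [← ENNReal.ofReal_mul (by positivity)]
    congr 1
    have : (2 : ℝ) - 1 = 1 := by norm_num
    simp [this, mul_comm]
  · simp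

theorem lintegral_exp_neg_expMeasure_one :
    ∫⁻ z, ENNReal.ofReal (Real.exp (-z)) ∂expMeasure 1 = 2⁻¹ := by
  rw [lintegral_expMeasure_one _ (by fun_prop)]
  have : ∀ z, exponentialPDF 1 z * ENNReal.ofReal (Real.exp (-z)) = 2⁻¹ * exponentialPDF 2 z := by
    intro z
    rw [exponentialPDF_eq, exponentialPDF_eq]
    split_ifs with hz
    · have h2 : (2⁻¹ : ℝ≥0∞) = ENNReal.ofReal 2⁻¹ := by
        rw [ENNReal.ofReal_inv_of_pos two_pos, ENNReal.ofReal_ofNat]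
      rw [h2, ← ENNReal.ofReal_mul (by positivity), ← ENNReal.ofReal_mul (by positivity)]
      congr 1
      rw [one_mul, ← Real.exp_add, ← mul_assoc]
      norm_num
      ring_nf
    · simp
  simp only [this]
  rw [lintegral_const_mul _ (measurable_exponentialPDF 2),
    lintegral_exponentialPDF_eq_one two_pos, mul_one]

end Exponential

/-! ### The canonical space of driving variables -/

/-- Realizations of the waiting times (left summand) and of the marks (right summand). -/
abbrev Config : Type := (ℕ+ × ℕ) ⊕ (ℕ+ × ℕ) → ℝ

namespace Config

/-- The waiting times. -/
def wait (x : ℕ+) (j : ℕ) (ω : Config) : ℝ := ω (Sum.inl (x, j))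

/-- The marks. -/
def hold (x : ℕ+) (j : ℕ) (ω : Config) : ℝ := ω (Sum.inr (x, j))

/-- The law of independent exponential variables of rate `1`. -/
noncomputable def law : Measure Config := Measure.infinitePi fun _ => expMeasure 1

instance : IsProbabilityMeasure law := inferInstanceAs (IsProbabilityMeasure (Measure.infinitePi _))

theorem measurable_wait (x : ℕ+) (j : ℕ) : Measurable (wait x j) := measurable_pi_apply _

theorem measurable_hold (x : ℕ+) (j : ℕ) : Measurable (hold x j) := measurable_pi_apply _

theorem wait_update_inl (ω : Config) (p : ℕ+ × ℕ) (z : ℝ) (y : ℕ+) (k : ℕ) :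
    wait y k (Function.update ω (Sum.inl p) z) = if (y, k) = p then z else wait y k ω := by
  simp [wait, Function.update_apply]

theorem hold_update_inl (ω : Config) (p : ℕ+ × ℕ) (z : ℝ) (y : ℕ+) (k : ℕ) :
    hold y k (Function.update ω (Sum.inl p) z) = hold y k ω := by
  simp [hold]

theorem wait_update_inr (ω : Config) (p : ℕ+ × ℕ) (z : ℝ) (y : ℕ+) (k : ℕ) :
    wait y k (Function.update ω (Sum.inr p) z) = wait y k ω := by
  simp [wait]

theorem hold_update_inr (ω : Config) (p : ℕ+ × ℕ) (z : ℝ) (y : ℕ+) (k : ℕ) :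
    hold y k (Function.update ω (Sum.inr p) z) = if (y, k) = p then z else hold y k ω := by
  simp [hold, Function.update_apply]

theorem ae_pos : ∀ᵐ ω ∂law, ∀ i, 0 < ω i := by
  refine ae_all_iff.2 fun i => ?_
  exact (measurePreserving_eval_infinitePi (fun _ => expMeasure 1) i).quasiMeasurePreserving.ae
    ae_expMeasure_pos

/-- By independence `n` distinct coordinates all miss `A` with probability the `n`-th power of a
number below one. -/
theorem ae_exists_mem {u : ℕ → (ℕ+ × ℕ) ⊕ (ℕ+ × ℕ)} (hu : Function.Injective u) {A : Set ℝ}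
    (hA : MeasurableSet A) (hpos : 0 < expMeasure 1 A) : ∀ᵐ ω ∂law, ∃ n, ω (u n) ∈ A := by
  have hlt : expMeasure 1 Aᶜ < 1 := by
    rw [prob_compl_eq_one_sub hA]
    exact ENNReal.sub_lt_self ENNReal.one_ne_top one_ne_zero hpos.ne'
  have hle : ∀ n, law {ω | ¬ ∃ n, ω (u n) ∈ A} ≤ (expMeasure 1 Aᶜ) ^ n := by
    intro n
    have h := Measure.infinitePi_pi (fun _ : (ℕ+ × ℕ) ⊕ (ℕ+ × ℕ) => expMeasure 1)
      (s := (Finset.range n).map ⟨u, hu⟩) (t := fun _ => Aᶜ) fun _ _ => hA.compl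
    rw [Finset.prod_const, Finset.card_map, Finset.card_range] at h
    rw [← h]
    refine measure_mono fun ω hω i hi => ?_
    obtain ⟨m, -, rfl⟩ := Finset.mem_map.1 (Finset.mem_coe.1 hi)
    exact fun hm => hω ⟨m, hm⟩
  exact le_antisymm (ge_of_tendsto' (ENNReal.tendsto_pow_atTop_nhds_zero_of_lt_one hlt) hle) bot_le

theorem eventTime_update_self {x : ℕ+} (j : ℕ) (ω : Config) (z : ℝ) :
    eventTime wait x j (Function.update ω (Sum.inl (x, 0)) z) =
      eventTime wait x j ω - wait x 0 ω + z := by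
  simp only [eventTime, wait_update_inl, Finset.sum_range_succ']
  simp

theorem eventTime_update_of_ne {x y : ℕ+} (hxy : y ≠ x) (i j : ℕ) (ω : Config) (z : ℝ) :
    eventTime wait y j (Function.update ω (Sum.inl (x, i)) z) = eventTime wait y j ω := by
  simp only [eventTime, wait_update_inl, Prod.mk.injEq, hxy, false_and, if_false]

/-- With everything else frozen, a coincidence pins the first waiting time of `x` to a single value,
and its law has no atoms. -/
theorem ae_eventTime_ne {x y : ℕ+} (hxy : x ≠ y) (j k : ℕ) :
    ∀ᵐ ω ∂law, eventTime wait x j ω ≠ eventTime wait y k ω := by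
  refine ae_infinitePi_of_ae_update _ (Sum.inl (x, 0))
    (A := {ω | eventTime wait x j ω ≠ eventTime wait y k ω}) ?_ (ae_of_all _ fun ω => ?_)
  · exact (measurableSet_eq_fun (measurable_eventTime measurable_wait x j)
      (measurable_eventTime measurable_wait y k)).compl
  · filter_upwards [measure_eq_zero_iff_ae_notMem.1 (measure_singleton (μ := expMeasure 1)
      (eventTime wait y k ω - eventTime wait x j ω + wait x 0 ω))] with z hz h
    rw [eventTime_update_self, eventTime_update_of_ne hxy.symm] at h
    exact hz (by rw [mem_singleton_iff]; linarith)

theorem ae_pairTime_inj : ∀ᵐ ω ∂law, ∀ p q, pairTime wait p ω = pairTime wait q ω → p = q := by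
  have h : ∀ᵐ ω ∂law, ∀ p q : ℕ+ × ℕ, p.1 ≠ q.1 → pairTime wait p ω ≠ pairTime wait q ω := by
    refine ae_all_iff.2 fun p => ae_all_iff.2 fun q => ?_
    by_cases hpq : p.1 = q.1
    · simp [hpq]
    · filter_upwards [ae_eventTime_ne hpq p.2 q.2] with ω hω _
      exact hω
  filter_upwards [h, ae_pos] with ω hω hpos p q hpq
  have h1 : p.1 = q.1 := by_contra fun h1 => hω p q h1 hpq
  refine Prod.ext h1 ((eventTime_lt (ξ := wait) (fun x j => hpos _) p.1).injective ?_)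
  rw [pairTime, pairTime, ← h1] at hpq
  exact hpq

theorem measurable_prod_exp_neg (x : ℕ+) (n : ℕ) :
    Measurable fun ω => ∏ i ∈ Finset.range n, ENNReal.ofReal (Real.exp (-wait x i ω)) :=
  Finset.measurable_prod _ fun i _ => (measurable_wait x i).neg.exp.ennreal_ofReal

theorem lintegral_prod_exp_neg (x : ℕ+) (n : ℕ) :
    ∫⁻ ω, ∏ i ∈ Finset.range n, ENNReal.ofReal (Real.exp (-wait x i ω)) ∂law = 2⁻¹ ^ n := by
  induction n with
  | zero => simp
  | succ n ih =>
    simp only [Finset.prod_range_succ]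
    rw [pow_succ, ← ih, ← lintegral_exp_neg_expMeasure_one]
    refine lintegral_infinitePi_mul (fun _ => expMeasure 1) (Sum.inl (x, n))
      (f := fun z => ENNReal.ofReal (Real.exp (-z)))
      (F := fun ω => ∏ i ∈ Finset.range n, ENNReal.ofReal (Real.exp (-wait x i ω)))
      (by fun_prop) (measurable_prod_exp_neg x n) fun ω z => ?_
    · refine Finset.prod_congr rfl fun i hi => ?_
      rw [wait_update_inl, if_neg]
      simp only [Prod.mk.injEq, true_and]
      exact (Finset.mem_range.1 hi).ne

theorem lintegral_prod_exp_neg_mul_hold (x : ℕ+) (n j : ℕ) :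
    ∫⁻ ω, (∏ i ∈ Finset.range n, ENNReal.ofReal (Real.exp (-wait x i ω))) *
      ENNReal.ofReal (hold x j ω) ∂law = 2⁻¹ ^ n := by
  rw [← lintegral_prod_exp_neg x n]
  refine Eq.trans ?_ (mul_one _)
  rw [← lintegral_id_expMeasure_one]
  refine lintegral_infinitePi_mul (fun _ => expMeasure 1) (Sum.inr (x, j))
    (f := fun z => ENNReal.ofReal z)
    (F := fun ω => ∏ i ∈ Finset.range n, ENNReal.ofReal (Real.exp (-wait x i ω)))
    (by fun_prop) (measurable_prod_exp_neg x n) fun ω z => ?_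
  · simp only [wait_update_inr]

/-- The Chernoff bound `1{σ ≤ s} ≤ e^{s - σ}` turns each term into a product of independent factors.
-/
theorem kClock_le_tsum {γ : ℕ+ → ℝ} (hγ : ∀ x, 0 < γ x) (s : ℝ) (ω : Config) :
    kClock γ wait hold s ω ≤ ∑' (x : ℕ+) (j : ℕ), ENNReal.ofReal (Real.exp s) *
      ENNReal.ofReal (γ x) * ((∏ i ∈ Finset.range (j + 1), ENNReal.ofReal (Real.exp (-wait x i ω))) *
        ENNReal.ofReal (hold x j ω)) := by
  refine ENNReal.tsum_le_tsum fun x => ENNReal.tsum_le_tsum fun j => ?_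
  split_ifs with h
  · rw [ENNReal.ofReal_mul (hγ x).le, ← ENNReal.ofReal_prod_of_nonneg fun i _ => (Real.exp_pos _).le,
      ← Real.exp_sum, Finset.sum_neg_distrib]
    have h1 : 1 ≤ ENNReal.ofReal (Real.exp s) * ENNReal.ofReal (Real.exp (-eventTime wait x j ω)) := by
      rw [← ENNReal.ofReal_mul (Real.exp_pos _).le, ← Real.exp_add, ← ENNReal.ofReal_one]
      refine ENNReal.ofReal_le_ofReal (Real.one_le_exp (by linarith))
    calc ENNReal.ofReal (γ x) * ENNReal.ofReal (hold x j ω)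
        ≤ (ENNReal.ofReal (Real.exp s) * ENNReal.ofReal (Real.exp (-eventTime wait x j ω))) *
          (ENNReal.ofReal (γ x) * ENNReal.ofReal (hold x j ω)) := le_mul_of_one_le_left' h1
      _ = _ := by rw [eventTime]; ring
  · exact bot_le

/-- The expectation of the bound in `kClock_le_tsum` is `e^s ∑ γ(x) ∑ 2^{-(j+1)}`, which is finite.
Integer `s` suffice by monotonicity. -/
theorem ae_kClock_ne_top {γ : ℕ+ → ℝ} (hγ : ∀ x, 0 < γ x) (hsum : Summable γ) :
    ∀ᵐ ω ∂law, ∀ s, kClock γ wait hold s ω ≠ ∞ := by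
  have h : ∀ n : ℕ, ∀ᵐ ω ∂law, kClock γ wait hold n ω ≠ ∞ := by
    intro n
    have hm' : ∀ (x : ℕ+) (j : ℕ), Measurable fun ω => (∏ i ∈ Finset.range (j + 1),
        ENNReal.ofReal (Real.exp (-wait x i ω))) * ENNReal.ofReal (hold x j ω) := fun x j =>
      (measurable_prod_exp_neg x (j + 1)).mul (measurable_hold x j).ennreal_ofReal
    have hm : ∀ (x : ℕ+) (j : ℕ), Measurable fun ω => ENNReal.ofReal (Real.exp n) *
        ENNReal.ofReal (γ x) * ((∏ i ∈ Finset.range (j + 1),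
          ENNReal.ofReal (Real.exp (-wait x i ω))) * ENNReal.ofReal (hold x j ω)) := fun x j =>
      (hm' x j).const_mul _
    have hfin : ∫⁻ ω, ∑' (x : ℕ+) (j : ℕ), ENNReal.ofReal (Real.exp n) *
        ENNReal.ofReal (γ x) * ((∏ i ∈ Finset.range (j + 1),
          ENNReal.ofReal (Real.exp (-wait x i ω))) * ENNReal.ofReal (hold x j ω)) ∂law ≠ ∞ := by
      rw [lintegral_tsum fun x => (Measurable.tsum fun j => hm x j).aemeasurable]
      have : ∀ x : ℕ+, ∫⁻ ω, ∑' (j : ℕ), ENNReal.ofReal (Real.exp n) *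
          ENNReal.ofReal (γ x) * ((∏ i ∈ Finset.range (j + 1),
          ENNReal.ofReal (Real.exp (-wait x i ω))) * ENNReal.ofReal (hold x j ω)) ∂law =
          ENNReal.ofReal (Real.exp n) * ENNReal.ofReal (γ x) * ∑' j : ℕ, 2⁻¹ ^ (j + 1) := by
        intro x
        rw [lintegral_tsum fun j => (hm x j).aemeasurable, ← ENNReal.tsum_mul_left]
        refine tsum_congr fun j => ?_
        rw [lintegral_const_mul _ (hm' x j), lintegral_prod_exp_neg_mul_hold]
      simp only [this]
      rw [ENNReal.tsum_mul_right, ENNReal.tsum_mul_left,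
        ← ENNReal.ofReal_tsum_of_nonneg (fun x => (hγ x).le) hsum, ENNReal.tsum_geometric_add_one]
      refine ENNReal.mul_ne_top (ENNReal.mul_ne_top ENNReal.ofReal_ne_top ENNReal.ofReal_ne_top) ?_
      simp
    filter_upwards [ae_lt_top (Measurable.tsum fun x => Measurable.tsum fun j => hm x j) hfin]
      with ω hω
    exact ((kClock_le_tsum hγ n ω).trans_lt hω).ne
  filter_upwards [ae_all_iff.2 h] with ω hω s
  obtain ⟨n, hn⟩ := exists_nat_ge s
  exact ne_top_of_le_ne_top (hω n) (kClock_mono hn)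

theorem ae_tsum_hold (x : ℕ+) : ∀ᵐ ω ∂law, ∑' j, ENNReal.ofReal (hold x j ω) = ∞ := by
  have h : ∀ N : ℕ, ∀ᵐ ω ∂law, ∃ n, ω (Sum.inr (x, N + n)) ∈ Ioc (1 : ℝ) 2 := fun N =>
    ae_exists_mem (u := fun n => Sum.inr (x, N + n)) (fun m n hmn => by simpa using hmn)
      measurableSet_Ioc (expMeasure_Ioc_pos zero_le_one one_lt_two)
  filter_upwards [ae_all_iff.2 h] with ω hω
  by_contra hne
  have h0 := ENNReal.tendsto_atTop_zero_of_tsum_ne_top hne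
  obtain ⟨N, hN⟩ := eventually_atTop.1 (h0.eventually (gt_mem_nhds one_pos))
  obtain ⟨n, hn⟩ := hω N
  refine absurd (hN (N + n) (by omega)) (not_lt.2 ?_)
  rw [ENNReal.one_le_ofReal]
  exact hn.1.le

theorem ae_dense : ∀ᵐ ω ∂law, ∀ a b : ℝ, 0 ≤ a → a < b →
    ∃ x, a < eventTime wait x 0 ω ∧ eventTime wait x 0 ω < b := by
  have h : ∀ p q : ℚ, 0 ≤ p → p < q → ∀ᵐ ω ∂law, ∃ n : ℕ,
      ω (Sum.inl (n.succPNat, 0)) ∈ Ioc (p : ℝ) q := fun p q hp hpq =>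
    ae_exists_mem (u := fun n => Sum.inl (n.succPNat, 0)) (fun m n hmn => by simpa using hmn)
      measurableSet_Ioc (expMeasure_Ioc_pos (by exact_mod_cast hp) (by exact_mod_cast hpq))
  have h' : ∀ᵐ ω ∂law, ∀ p q : ℚ, 0 ≤ p → p < q → ∃ n : ℕ,
      ω (Sum.inl (n.succPNat, 0)) ∈ Ioc (p : ℝ) q := by
    simp only [ae_all_iff]
    exact h
  filter_upwards [h'] with ω hω a b ha hab
  obtain ⟨p, hp1, hp2⟩ := exists_rat_btwn hab
  obtain ⟨q, hq1, hq2⟩ := exists_rat_btwn hp2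
  obtain ⟨n, hn⟩ := hω p q (by exact_mod_cast (ha.trans hp1.le)) (by exact_mod_cast hq1)
  refine ⟨n.succPNat, ?_⟩
  simp only [eventTime, zero_add, Finset.range_one, Finset.sum_singleton, wait]
  exact ⟨hp1.trans hn.1, hn.2.trans_lt hq2⟩

theorem ae_isRegularClock {γ : ℕ+ → ℝ} (hγ : ∀ x, 0 < γ x) (hsum : Summable γ) :
    ∀ᵐ ω ∂law, IsRegularClock γ wait hold ω := by
  filter_upwards [ae_pos, ae_pairTime_inj, ae_kClock_ne_top hγ hsum,
    ae_all_iff.2 ae_tsum_hold, ae_dense] with ω h1 h2 h3 h4 h5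
  exact { wait_pos := fun x j => h1 _, hold_nonneg := fun x j => (h1 _).le, inj := h2,
          finite := h3, infinite := h4, hold_pos := fun x j => h1 _, dense := h5 }

end Config

namespace Config

variable {γ : ℕ+ → ℝ}

/-! ### The state at a fixed time is finite -/

theorem pairTime_update_inr (ω : Config) (p : ℕ+ × ℕ) (z : ℝ) (q : ℕ+ × ℕ) :
    pairTime wait q (Function.update ω (Sum.inr p) z) = pairTime wait q ω := by
  simp only [pairTime, eventTime, wait_update_inr]

theorem kClock_update_inr (ω : Config) (p : ℕ+ × ℕ) (z s : ℝ) :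
    kClock γ wait hold s (Function.update ω (Sum.inr p) z) =
      kClock γ wait hold s (Function.update ω (Sum.inr p) 0) +
        if pairTime wait p ω ≤ s then ENNReal.ofReal (γ p.1 * z) else 0 := by
  rw [kClock_eq_tsum, kClock_eq_tsum, ← tsum_ite_eq p (fun _ : ℕ+ × ℕ =>
    if pairTime wait p ω ≤ s then ENNReal.ofReal (γ p.1 * z) else 0), ← ENNReal.tsum_add]
  refine tsum_congr fun q => ?_
  simp only [pairTime_update_inr, hold_update_inr, Prod.mk.eta]
  by_cases hq : q = p
  · subst hq
    simp
  · simp [hq]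

theorem kClockLeft_update_inr_le (ω : Config) (p : ℕ+ × ℕ) (z s : ℝ) :
    kClockLeft γ wait hold s (Function.update ω (Sum.inr p) z) ≤
      kClockLeft γ wait hold s (Function.update ω (Sum.inr p) 0) + ENNReal.ofReal (γ p.1 * z) := by
  refine iSup_le fun r => ?_
  rw [kClock_update_inr]
  refine add_le_add (kClock_le_kClockLeft r.2) ?_
  split_ifs
  · exact le_rfl
  · exact bot_le

/-- Positivity of the marks is lost here, which is why the covering of almost all times was proved
for tame clocks. -/
theorem isTameClock_update_zero {ω : Config} (h : IsTameClock γ wait hold ω) (x : ℕ+) :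
    IsTameClock γ wait hold (Function.update ω (Sum.inr (x, 0)) 0) where
  wait_pos y k := by
    rw [wait_update_inr]
    exact h.wait_pos y k
  hold_nonneg y k := by
    rw [hold_update_inr]
    split_ifs
    · exact le_rfl
    · exact h.hold_nonneg y k
  inj p q hpq := by
    rw [pairTime_update_inr, pairTime_update_inr] at hpq
    exact h.inj p q hpq
  finite s := by
    refine ne_top_of_le_ne_top (h.finite s) ?_
    conv_rhs => rw [← Function.update_eq_self (Sum.inr (x, 0)) ω, kClock_update_inr]
    exact le_self_add
  infinite y := by
    have h1 := h.infinite y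
    rw [tsum_eq_zero_add' ENNReal.summable] at h1 ⊢
    have h2 := (ENNReal.add_eq_top.1 h1).resolve_left ENNReal.ofReal_ne_top
    refine ENNReal.add_eq_top.2 (Or.inr ?_)
    simpa [hold_update_inr] using h2

/-- Past the first holding interval of `x`, the path with mark `z` is the path with mark `0` delayed
by `γ x * z`. So `t` either lies in that interval or inherits its cover from `t - γ x * z`. -/
theorem exists_inHold_of_update {ω : Config} {x : ℕ+} {z : ℝ} {t : ℝ≥0} (hz : 0 ≤ γ x * z)
    (h : 0 ≤ (t : ℝ) - γ x * z → ∃ p, InHold γ wait hold ((t : ℝ) - γ x * z).toNNReal p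
      (Function.update ω (Sum.inr (x, 0)) 0))
    (hst : holdStart γ wait hold (x, 0) (Function.update ω (Sum.inr (x, 0)) z) ≤ t) :
    ∃ p, InHold γ wait hold t p (Function.update ω (Sum.inr (x, 0)) z) := by
  by_cases hend : (t : ℝ≥0∞) < holdEnd γ wait hold (x, 0) (Function.update ω (Sum.inr (x, 0)) z)
  · exact ⟨(x, 0), hst, hend⟩
  rw [not_lt, holdEnd, pairTime_update_inr, kClock_update_inr, if_pos le_rfl] at hend
  have ht : (t : ℝ≥0∞) = ENNReal.ofReal t := by simp
  have hle : γ x * z ≤ t := by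
    have := le_add_self.trans hend
    rw [ht] at this
    exact (ENNReal.ofReal_le_ofReal_iff t.2).1 this
  have hadd : ENNReal.ofReal ((t : ℝ) - γ x * z) + ENNReal.ofReal (γ x * z) = t := by
    rw [← ENNReal.ofReal_add (by linarith) hz, sub_add_cancel, ht]
  obtain ⟨p, hp1, hp2⟩ := h (by linarith)
  change holdStart γ wait hold p _ ≤ ENNReal.ofReal _ at hp1
  change ENNReal.ofReal _ < holdEnd γ wait hold p _ at hp2
  rw [← hadd, ENNReal.add_le_add_iff_right ENNReal.ofReal_ne_top] at hend
  -- An event up to that of `(x, 0)` has a holding interval that is already over at the shifted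
  -- time.
  have hlt : pairTime wait (x, 0) ω < pairTime wait p ω := by
    by_contra hcon
    refine absurd (hp2.trans_le ?_) (lt_irrefl _)
    rw [holdEnd, pairTime_update_inr]
    exact (kClock_mono (not_lt.1 hcon)).trans hend
  refine ⟨p, ?_, ?_⟩
  · rw [holdStart, pairTime_update_inr] at hp1 ⊢
    rw [← hadd]
    exact (kClockLeft_update_inr_le ω (x, 0) z _).trans (by gcongr)
  · rw [holdEnd, pairTime_update_inr] at hp2 ⊢
    rw [kClock_update_inr, if_pos hlt.le, ← hadd]
    exact ENNReal.add_lt_add_right ENNReal.ofReal_ne_top hp2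

/-- Resample the first mark of a state already entered by time `t`. The shifted time `t - γ x * z`
then has an absolutely continuous law, so it avoids the null set of uncovered times. -/
theorem ae_exists_inHold (hγ : ∀ x, 0 < γ x) (hsum : Summable γ) {t : ℝ≥0} (ht : 0 < t) :
    ∀ᵐ ω ∂law, ∃ p, InHold γ wait hold t p ω := by
  have key : ∀ x : ℕ+, ∀ᵐ ω ∂law, holdStart γ wait hold (x, 0) ω ≤ t →
      ∃ p, InHold γ wait hold t p ω := by
    intro x
    refine ae_infinitePi_of_ae_update _ (Sum.inr (x, 0))
      (A := {ω | holdStart γ wait hold (x, 0) ω ≤ t → ∃ p, InHold γ wait hold t p ω}) ?_ ?_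
    · have : {ω | holdStart γ wait hold (x, 0) ω ≤ t → ∃ p, InHold γ wait hold t p ω} =
          {ω | holdStart γ wait hold (x, 0) ω ≤ t}ᶜ ∪ ⋃ p, {ω | InHold γ wait hold t p ω} := by
        ext ω
        simp [imp_iff_not_or]
      rw [this]
      exact (measurableSet_le (measurable_holdStart measurable_wait measurable_hold _)
        measurable_const).compl.union (MeasurableSet.iUnion fun p =>
          measurableSet_inHold measurable_wait measurable_hold t p)
    · filter_upwards [ae_isRegularClock hγ hsum] with ω hω
      have hae := (isTameClock_update_zero hω.toIsTameClock x).ae_exists_inHold hγ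
      have haff : ∀ᵐ z : ℝ, 0 ≤ (t : ℝ) - γ x * z → ∃ p, InHold γ wait hold
          ((t : ℝ) - γ x * z).toNNReal p (Function.update ω (Sum.inr (x, 0)) 0) := by
        have hq : Measure.QuasiMeasurePreserving (fun z : ℝ => (t : ℝ) - γ x * z) := by
          refine (Measure.measurePreserving_sub_left volume (t : ℝ)).quasiMeasurePreserving.comp
            (g := fun y => (t : ℝ) - y) (f := fun z => γ x * z) ⟨by fun_prop, ?_⟩
          rw [Real.map_volume_mul_left (hγ x).ne']
          exact Measure.smul_absolutelyContinuous
        exact hq.ae hae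
      filter_upwards [(expMeasure_absolutelyContinuous 1).ae_le haff, ae_expMeasure_pos]
        with z hz hz0 hst
      exact exists_inHold_of_update (mul_pos (hγ x) hz0).le hz hst
  filter_upwards [ae_all_iff.2 key, ae_isRegularClock hγ hsum] with ω hω hreg
  -- Some time in `(0, t)` is covered, which provides a state first entered by time `t`.
  obtain ⟨u, hu, hu0, hut⟩ := (Measure.dense_of_ae
    (hreg.toIsTameClock.ae_exists_inHold hγ)).exists_between (NNReal.coe_pos.2 ht)
  obtain ⟨p, hp⟩ := hu hu0.le
  refine hω p.1 (((kClockLeft_mono ?_).trans hp.1).trans ?_)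
  · exact (eventTime_lt hreg.wait_pos p.1).monotone (Nat.zero_le p.2)
  · exact_mod_cast Real.toNNReal_le_iff_le_coe.2 hut.le

/-! ### Returns to the current state and visits to a finite set of states -/

theorem eventTime_update_of_le {x y : ℕ+} {j k : ℕ} (h : y = x → k ≤ j) (ω : Config) (z : ℝ) :
    eventTime wait y k (Function.update ω (Sum.inl (x, j + 1)) z) = eventTime wait y k ω := by
  refine Finset.sum_congr rfl fun i hi => ?_
  rw [wait_update_inl, if_neg]
  rintro hi'
  obtain ⟨rfl, rfl⟩ := Prod.mk.inj hi'
  have := h rfl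
  simp at hi
  omega

/-- Only later events of `x` move, and for either positive value of the wait they come after `s`. -/
theorem kClock_update_inl {ω : Config} (hω : ∀ x j, 0 < wait x j ω) {z : ℝ} (hz : 0 < z)
    {x : ℕ+} {j : ℕ} {s : ℝ} (hs : s ≤ eventTime wait x j ω) :
    kClock γ wait hold s (Function.update ω (Sum.inl (x, j + 1)) z) =
      kClock γ wait hold s ω := by
  have hω' : ∀ y k, 0 < wait y k (Function.update ω (Sum.inl (x, j + 1)) z) := by
    intro y k
    rw [wait_update_inl]
    split_ifs
    · exact hz
    · exact hω y k
  refine tsum_congr fun y => tsum_congr fun k => ?_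
  rw [hold_update_inl]
  by_cases h : y = x → k ≤ j
  · rw [eventTime_update_of_le h]
  · push Not at h
    obtain ⟨rfl, hk⟩ := h
    have h1 := eventTime_lt hω y hk
    have h2 := eventTime_lt hω' y hk
    simp only [eventTime_update_of_le (fun _ => le_refl j)] at h2
    rw [if_neg (by linarith), if_neg (by linarith)]

theorem inHold_update_inl {ω : Config} (hω : ∀ x j, 0 < wait x j ω) {z : ℝ} (hz : 0 < z)
    {x : ℕ+} {j : ℕ} {t : ℝ≥0} :
    InHold γ wait hold t (x, j) (Function.update ω (Sum.inl (x, j + 1)) z) ↔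
      InHold γ wait hold t (x, j) ω := by
  have h1 : pairTime wait (x, j) (Function.update ω (Sum.inl (x, j + 1)) z) =
      pairTime wait (x, j) ω := eventTime_update_of_le (fun _ => le_rfl) ω z
  have h2 : kClockLeft γ wait hold (pairTime wait (x, j) ω)
      (Function.update ω (Sum.inl (x, j + 1)) z) =
      kClockLeft γ wait hold (pairTime wait (x, j) ω) ω :=
    iSup_congr fun r => kClock_update_inl hω hz (le_of_lt r.2)
  rw [InHold, holdStart, holdEnd, h1, h2, kClock_update_inl hω hz le_rfl]
  rfl

/-- Holding at `t` in the `j`-th visit to `x` is decided before the next wait of `x`, hence is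
independent of it. -/
theorem measure_inHold_and_wait_le (t : ℝ≥0) (x : ℕ+) (j : ℕ) (ε : ℝ) :
    law {ω | InHold γ wait hold t (x, j) ω ∧ wait x (j + 1) ω ≤ ε} =
      law {ω | InHold γ wait hold t (x, j) ω} * expMeasure 1 (Iic ε) := by
  set i : (ℕ+ × ℕ) ⊕ (ℕ+ × ℕ) := Sum.inl (x, j + 1)
  -- The holding event ignores coordinate `i` only among positive values. Fixing it at `1` gives an
  -- almost surely equal event that ignores it everywhere.
  set E : Set Config := {ω | InHold γ wait hold t (x, j) (Function.update ω i 1)}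
  have hup : Measurable fun ω : Config => Function.update ω i 1 := measurable_update_left
  have hE : MeasurableSet E := hup (measurableSet_inHold measurable_wait measurable_hold t (x, j))
  have hae : ∀ᵐ ω ∂law, ω ∈ E ↔ InHold γ wait hold t (x, j) ω := by
    filter_upwards [ae_pos] with ω hω
    exact inHold_update_inl (fun _ _ => hω _) one_pos
  have h := lintegral_infinitePi_mul (fun _ => expMeasure 1) i (f := (Iic ε).indicator 1)
    (F := E.indicator 1) (measurable_one.indicator measurableSet_Iic) (measurable_one.indicator hE)
    (fun ω z => by
      refine congrArg (fun ω' => {ω' | InHold γ wait hold t (x, j) ω'}.indicator 1 ω')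
        (Function.update_idem z (1 : ℝ) ω))
  rw [lintegral_indicator_one measurableSet_Iic, lintegral_indicator_one hE] at h
  have hE' : law E = law {ω | InHold γ wait hold t (x, j) ω} := by
    refine measure_congr ?_
    filter_upwards [hae] with ω hω
    exact propext hω
  rw [← hE', law, ← h, ← law]
  have hS : MeasurableSet (E ∩ {ω | wait x (j + 1) ω ≤ ε}) :=
    hE.inter (measurableSet_le (measurable_wait _ _) measurable_const)
  have : law {ω | InHold γ wait hold t (x, j) ω ∧ wait x (j + 1) ω ≤ ε} =
      law (E ∩ {ω | wait x (j + 1) ω ≤ ε}) := by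
    refine measure_congr ?_
    filter_upwards [hae] with ω hω
    exact propext (and_congr_left' hω.symm)
  rw [this, ← lintegral_indicator_one hS]
  refine lintegral_congr fun ω => ?_
  rw [inter_indicator_one]
  rfl

/-- The holding events of different pairs are almost surely disjoint, so their probabilities sum to
at most one; the bound is uniform in `t`. -/
theorem measure_exists_inHold_and_wait_le (hγ : ∀ x, 0 < γ x) (hsum : Summable γ) (t : ℝ≥0)
    (ε : ℝ) : law {ω | ∃ p, InHold γ wait hold t p ω ∧ wait p.1 (p.2 + 1) ω ≤ ε} ≤
      expMeasure 1 (Iic ε) := by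
  have h1 : ∑' p : ℕ+ × ℕ, law {ω | InHold γ wait hold t p ω} ≤ 1 := by
    refine (tsum_meas_le_meas_iUnion_of_disjoint₀ law (fun p =>
      (measurableSet_inHold measurable_wait measurable_hold t p).nullMeasurableSet) ?_).trans
      prob_le_one
    intro p q hpq
    refine measure_mono_null ?_ (ae_iff.1 (ae_isRegularClock hγ hsum))
    exact fun ω hω hreg => hpq (hreg.inHold_unique hω.1 hω.2)
  rw [ofPred_exists]
  refine (measure_iUnion_le _).trans ?_
  calc ∑' p : ℕ+ × ℕ, law {ω | InHold γ wait hold t p ω ∧ wait p.1 (p.2 + 1) ω ≤ ε}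
      = (∑' p : ℕ+ × ℕ, law {ω | InHold γ wait hold t p ω}) * expMeasure 1 (Iic ε) := by
        rw [← ENNReal.tsum_mul_right]
        exact tsum_congr fun p => measure_inHold_and_wait_le t p.1 p.2 ε
    _ ≤ 1 * expMeasure 1 (Iic ε) := by gcongr
    _ = _ := one_mul _

theorem tendsto_measure_le_zero {Ω : Type*} [MeasurableSpace Ω] {μ : Measure Ω}
    [IsFiniteMeasure μ] {X : Ω → ℝ≥0∞} (hX : Measurable X) (hpos : ∀ᵐ ω ∂μ, 0 < X ω) (c : ℝ≥0) :
    Tendsto (fun t : ℝ≥0 => μ {ω | X ω ≤ (t * c : ℝ≥0)}) (𝓝[>] 0) (𝓝 0) := by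
  have h := tendsto_measure_of_ae_tendsto_indicator_of_isFiniteMeasure (μ := μ) (𝓝[>] (0 : ℝ≥0))
    (A := ∅) (As := fun t : ℝ≥0 => {ω | X ω ≤ (t * c : ℝ≥0)}) MeasurableSet.empty
    (fun t => measurableSet_le hX measurable_const) ?_
  · simpa using h
  · filter_upwards [hpos] with ω hω
    have hc : Tendsto (fun t : ℝ≥0 => ((t * c : ℝ≥0) : ℝ≥0∞)) (𝓝[>] 0) (𝓝 0) := by
      have : Continuous fun t : ℝ≥0 => ((t * c : ℝ≥0) : ℝ≥0∞) := by fun_prop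
      simpa using (this.tendsto 0).mono_left nhdsWithin_le_nhds
    filter_upwards [hc.eventually (gt_mem_nhds hω)] with t ht
    simpa using ht

/-- The state occupied at time `t` is entered again by time `u`, or one of the first `K` states is
visited by time `u`. -/
def returnEvent (γ : ℕ+ → ℝ) (t u : ℝ≥0) (K : ℕ+) : Set Config :=
  {ω | ∃ p, InHold γ wait hold t p ω ∧ holdStart γ wait hold (p.1, p.2 + 1) ω ≤ u} ∪
    ⋃ x ∈ Iic K, {ω | holdStart γ wait hold (x, 0) ω ≤ u}

theorem measurableSet_returnEvent (t u : ℝ≥0) (K : ℕ+) :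
    MeasurableSet (returnEvent γ t u K) := by
  have hst : ∀ p, MeasurableSet {ω : Config | holdStart γ wait hold p ω ≤ u} := fun p =>
    measurableSet_le (measurable_holdStart measurable_wait measurable_hold p) measurable_const
  refine MeasurableSet.union ?_ (MeasurableSet.iUnion fun x => MeasurableSet.iUnion fun _ => hst _)
  rw [ofPred_exists]
  exact MeasurableSet.iUnion fun p =>
    (measurableSet_inHold measurable_wait measurable_hold t p).inter (hst _)

/-- If the next wait of the occupied state exceeds `ε`, so does the time of its next event, and a
return by `u` forces `Γ(ε) ≤ u`. -/
theorem measure_returnEvent_le (hγ : ∀ x, 0 < γ x) (hsum : Summable γ) (t u : ℝ≥0) (K : ℕ+)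
    (ε : ℝ) : law (returnEvent γ t u K) ≤ expMeasure 1 (Iic ε) +
      law {ω | kClock γ wait hold ε ω ≤ u} +
      ∑ x ∈ Finset.Iic K, law {ω | holdStart γ wait hold (x, 0) ω ≤ u} := by
  refine (measure_union_le _ _).trans (add_le_add ?_ ?_)
  · refine le_trans ?_ ((measure_union_le _ _).trans
      (add_le_add_left (measure_exists_inHold_and_wait_le hγ hsum t ε) _))
    refine measure_mono_ae ?_
    filter_upwards [ae_isRegularClock hγ hsum] with ω hω hp
    obtain ⟨p, hp, hu⟩ := hp
    by_cases hw : wait p.1 (p.2 + 1) ω ≤ ε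
    · exact Or.inl ⟨p, hp, hw⟩
    · refine Or.inr ((kClock_le_kClockLeft ?_).trans hu)
      simp only [pairTime, eventTime]
      rw [Finset.sum_range_succ]
      exact (not_le.1 hw).trans (lt_add_of_pos_left _ (eventTime_pos hω.wait_pos p.1 p.2))
  · have := measure_biUnion_finset_le (μ := law) (Finset.Iic K)
      fun x => {ω | holdStart γ wait hold (x, 0) ω ≤ u}
    simpa using this

theorem tendsto_measure_returnEvent (hγ : ∀ x, 0 < γ x) (hsum : Summable γ) (c : ℝ≥0) (K : ℕ+) :
    Tendsto (fun t : ℝ≥0 => law (returnEvent γ t (t * c) K)) (𝓝[>] 0) (𝓝 0) := by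
  have hst : ∀ x : ℕ+, Tendsto (fun t : ℝ≥0 =>
      law {ω | holdStart γ wait hold (x, 0) ω ≤ (t * c : ℝ≥0)}) (𝓝[>] 0) (𝓝 0) := fun x =>
    tendsto_measure_le_zero (measurable_holdStart measurable_wait measurable_hold _)
      ((ae_isRegularClock hγ hsum).mono fun ω hω => hω.holdStart_pos hγ _) c
  have hclock : ∀ ε : ℝ, 0 < ε → Tendsto (fun t : ℝ≥0 =>
      law {ω | kClock γ wait hold ε ω ≤ (t * c : ℝ≥0)}) (𝓝[>] 0) (𝓝 0) := fun ε hε =>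
    tendsto_measure_le_zero (measurable_kClock measurable_wait measurable_hold measurable_const)
      ((ae_isRegularClock hγ hsum).mono fun ω hω => hω.kClock_pos hγ hε) c
  have hexp := tendsto_measure_le_zero (μ := expMeasure 1) (X := ENNReal.ofReal)
    (by fun_prop) (ae_expMeasure_pos.mono fun z hz => ENNReal.ofReal_pos.2 hz) 1
  rw [ENNReal.tendsto_nhds_zero]
  intro δ hδ
  obtain ⟨δ', hδ', hlt⟩ := exists_between hδ
  -- First `ε` makes the term uniform in `t` small; with this `ε` fixed the other terms vanish as `t
  -- → 0`.
  obtain ⟨ε, hε, hε0⟩ := ((ENNReal.tendsto_nhds_zero.1 hexp δ' hδ').and self_mem_nhdsWithin).exists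
  have hε1 : expMeasure 1 (Iic (ε : ℝ)) ≤ δ' := by
    refine (measure_mono fun z hz => ?_).trans hε
    rw [mem_ofPred_eq, mul_one]
    exact ENNReal.ofReal_le_of_le_toReal (by simpa using hz)
  have hlim := (hclock ε hε0).add (tendsto_finsetSum (Finset.Iic K) fun x _ => hst x)
  simp only [Finset.sum_const_zero, add_zero] at hlim
  filter_upwards [ENNReal.tendsto_nhds_zero.1 hlim (δ - δ') (tsub_pos_of_lt hlt)] with t ht
  refine (measure_returnEvent_le hγ hsum t (t * c) K ε).trans ?_
  rw [add_assoc]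
  exact (add_le_add hε1 ht).trans (add_tsub_cancel_of_le hlt.le).le

end Config

/-! ### The exit time from the current state -/

section Exit

variable {Ω : Type*} {γ : ℕ+ → ℝ} {ξ T : ℕ+ → ℕ → Ω → ℝ} {ω : Ω}

open Classical in
/-- The end of the holding interval that contains `t`. -/
noncomputable def exitTime (γ : ℕ+ → ℝ) (ξ T : ℕ+ → ℕ → Ω → ℝ) (t : ℝ≥0) (ω : Ω) : ℝ≥0∞ :=
  ⨆ p, if InHold γ ξ T t p ω then holdEnd γ ξ T p ω else 0

/-- The remaining holding time at time `t`, in units of `t`. -/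
noncomputable def relStay (γ : ℕ+ → ℝ) (ξ T : ℕ+ → ℕ → Ω → ℝ) (t : ℝ≥0) (ω : Ω) : ℝ :=
  ((exitTime γ ξ T t ω).toReal - t) / t

theorem measurable_relStay [MeasurableSpace Ω] (hξ : ∀ x j, Measurable (ξ x j))
    (hT : ∀ x j, Measurable (T x j)) (t : ℝ≥0) : Measurable (relStay γ ξ T t) := by
  have : Measurable (exitTime γ ξ T t) := Measurable.iSup fun p =>
    Measurable.ite (measurableSet_inHold hξ hT t p) (measurable_holdEnd hξ hT p) measurable_const
  exact (this.ennreal_toReal.sub_const _).div_const _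

theorem IsTameClock.exitTime_eq (h : IsTameClock γ ξ T ω) {t : ℝ≥0} {p : ℕ+ × ℕ}
    (hp : InHold γ ξ T t p ω) : exitTime γ ξ T t ω = holdEnd γ ξ T p ω := by
  refine le_antisymm (iSup_le fun q => ?_) (le_iSup_of_le p (by rw [if_pos hp]))
  split_ifs with hq
  · rw [h.inHold_unique hp hq]
  · exact bot_le

theorem IsTameClock.exists_exit (h : IsTameClock γ ξ T ω) {t : ℝ≥0} (ht : 0 < t) {p : ℕ+ × ℕ}
    (hp : InHold γ ξ T t p ω) : ∃ s : ℝ≥0, 0 < s ∧ relStay γ ξ T t ω = s ∧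
      ((t * (1 + s) : ℝ≥0) : ℝ≥0∞) = holdEnd γ ξ T p ω := by
  obtain ⟨b, hb⟩ := WithTop.ne_top_iff_exists.1 (h.finite (pairTime ξ p ω))
  change (b : ℝ≥0∞) = holdEnd γ ξ T p ω at hb
  have htb : t < b := by
    have := hp.2
    rw [← hb] at this
    exact_mod_cast this
  have hsub : 0 < b - t := tsub_pos_of_lt htb
  refine ⟨(b - t) / t, by positivity, ?_, ?_⟩
  · rw [relStay, h.exitTime_eq hp, ← hb, ENNReal.coe_toReal, NNReal.coe_div,
      NNReal.coe_sub htb.le]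
  · rw [← hb, mul_add, mul_one, mul_div_cancel₀ _ ht.ne', add_tsub_cancel_of_le htb.le]

theorem IsTameClock.kPath_eq_coe_iff (h : IsTameClock γ ξ T ω) (hγ : ∀ x, 0 < γ x) {t : ℝ≥0}
    {x : ℕ+} : (kPath γ ξ T ω).1 t = (x : NBar) ↔ ∃ j, InHold γ ξ T t (x, j) ω := by
  rw [h.kPath_apply hγ, h.kState_eq_coe_iff]

theorem IsTameClock.kPath_eq_of_mem (h : IsTameClock γ ξ T ω) (hγ : ∀ x, 0 < γ x) {t r : ℝ≥0}
    {p : ℕ+ × ℕ} (hp : InHold γ ξ T t p ω) (htr : t ≤ r)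
    (hr : (r : ℝ≥0∞) < holdEnd γ ξ T p ω) : (kPath γ ξ T ω).1 r = (p.1 : NBar) :=
  (h.kPath_eq_coe_iff hγ).2 ⟨p.2, hp.1.trans (by exact_mod_cast htr), hr⟩

theorem IsRegularClock.kPath_holdEnd_ne (h : IsRegularClock γ ξ T ω) (hγ : ∀ x, 0 < γ x) {b : ℝ≥0}
    {p : ℕ+ × ℕ} (hb : (b : ℝ≥0∞) = holdEnd γ ξ T p ω) (x : ℕ+) :
    (kPath γ ξ T ω).1 b ≠ (x : NBar) := by
  rw [Ne, h.kPath_eq_coe_iff hγ]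
  rintro ⟨j, hj⟩
  exact h.not_inHold_holdEnd hγ hb _ hj

/-- At the exit time itself the state has already changed, hence the strict inequality. Expectations
of `phiOne` are thus tails of `relStay`. -/
theorem IsRegularClock.phiOne_eq (h : IsRegularClock γ ξ T ω) (hγ : ∀ x, 0 < γ x) {t : ℝ≥0}
    (ht : 0 < t) {p : ℕ+ × ℕ} (hp : InHold γ ξ T t p ω) (r : ℝ≥0) :
    phiOne t (r * t) (kPath γ ξ T ω) = if (r : ℝ) < relStay γ ξ T t ω then 1 else 0 := by
  obtain ⟨s, hs0, hs, hb⟩ := h.exists_exit ht hp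
  have htx := h.kPath_eq_of_mem hγ hp le_rfl hp.2
  classical
  rw [phiOne, hs, htx]
  refine if_congr ⟨fun hall => ?_, fun hrs u hu => h.kPath_eq_of_mem hγ hp hu.1 ?_⟩ rfl rfl
  · by_contra hcon
    rw [not_lt, NNReal.coe_le_coe] at hcon
    refine h.kPath_holdEnd_ne hγ hb p.1 (hall _ ⟨le_mul_of_one_le_right' (by simp), ?_⟩)
    rw [mul_add, mul_one, mul_comm t s]
    gcongr
  · rw [← hb, ENNReal.coe_lt_coe]
    refine hu.2.trans_lt ?_
    rw [mul_add, mul_one, mul_comm t s]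
    have := NNReal.coe_lt_coe.1 hrs
    gcongr

/-- An exit exactly at `t * (1 + θ)` would leave that time outside every holding interval. This
excludes the boundary case that the defining properties of an observable leave open. -/
theorem IsRegularClock.relStay_ne (h : IsRegularClock γ ξ T ω) (hγ : ∀ x, 0 < γ x) {t θ : ℝ≥0}
    (ht : 0 < t) {p q : ℕ+ × ℕ} (hp : InHold γ ξ T t p ω) (hq : InHold γ ξ T (t * (1 + θ)) q ω) :
    relStay γ ξ T t ω ≠ θ := by
  obtain ⟨s, hs0, hs, hb⟩ := h.exists_exit ht hp
  rw [hs]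
  intro hsθ
  rw [NNReal.coe_inj.1 hsθ] at hb
  exact h.not_inHold_holdEnd hγ hb q hq

end Exit

/-! ### Observables along the trajectory -/

theorem IsCadlag.comp_strictMono {α β : Type*} [TopologicalSpace α] [Preorder α]
    [TopologicalSpace β] [Preorder β] {f : β → NBar} (hf : IsCadlag f) {g : α → β}
    (hg : Continuous g) (hmono : StrictMono g) (hle : Monotone g) : IsCadlag (fun a => f (g a)) := by
  intro a
  refine ⟨(hf (g a)).1.comp hg.continuousWithinAt fun b (hb : a ≤ b) => hle hb, ?_⟩
  obtain ⟨l, hl⟩ := (hf (g a)).2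
  refine ⟨l, hl.comp (tendsto_nhdsWithin_iff.2 ⟨hg.continuousAt.mono_left nhdsWithin_le_nhds, ?_⟩)⟩
  filter_upwards [self_mem_nhdsWithin] with b hb
  exact hmono hb

/-- The segment of length `u` of a path that starts at time `a`. -/
def pathSegment (ζ : CadlagPath ℝ≥0) (a u : ℝ≥0) : PathSegment u :=
  ⟨fun r => ζ.1 (a + r), ζ.2.comp_strictMono (by fun_prop)
    (fun r r' h => add_lt_add_right (show (r : ℝ≥0) < r' from h) a)
    (fun r r' h => add_le_add_right (show (r : ℝ≥0) ≤ r' from h) a)⟩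

theorem NBar.d_infty_le {K : ℕ+} {y : NBar} (h : ∀ x ≤ K, y ≠ (x : NBar)) :
    NBar.d y OnePoint.infty ≤ ((K : ℕ) : ℝ)⁻¹ := by
  induction y using OnePoint.rec with
  | infty => simp [NBar.d]
  | coe y =>
    have hy : K < y := not_le.1 fun hy => h y hy rfl
    have hK : (0 : ℝ) < (K : ℕ) := by exact_mod_cast K.pos
    have : NBar.d (y : NBar) OnePoint.infty = ((y : ℕ) : ℝ)⁻¹ := by
      change |((y : ℕ) : ℝ)⁻¹ - 0| = _
      rw [sub_zero, abs_of_nonneg (by positivity)]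
    rw [this]
    exact inv_anti₀ hK (by exact_mod_cast hy.le)

section Observable

variable {Ω : Type*} {γ : ℕ+ → ℝ} {ξ T : ℕ+ → ℕ → Ω → ℝ} {ω : Ω}
  {Φ : ℝ≥0 → ℝ≥0 → CadlagPath ℝ≥0 → ℝ} {Ψ₁ : ℝ≥0 → ℝ}
  {Ξ : (θ : ℝ≥0) → ℕ+ → (s : ℝ≥0) → PathSegment (θ - s) → ℝ} {Ψ₂ : ℝ → ℝ → ℝ}

theorem IsTwoTimeObservable.eq_scale (h : IsTwoTimeObservable Φ Ψ₁ Ξ Ψ₂) {t θ : ℝ≥0} (ht : 0 < t)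
    (hθ : 0 < θ) (ζ : CadlagPath ℝ≥0) : Φ t (θ * t) ζ = Φ 1 θ (scalePath t ht ζ) := by
  rw [h.scaling t (θ * t) ht (mul_pos hθ ht), mul_div_cancel_right₀ _ ht.ne']

theorem IsTwoTimeObservable.eq_of_lt_relStay (h : IsTwoTimeObservable Φ Ψ₁ Ξ Ψ₂)
    (hω : IsRegularClock γ ξ T ω) (hγ : ∀ x, 0 < γ x) {t θ : ℝ≥0} (ht : 0 < t) (hθ : 0 < θ)
    {p : ℕ+ × ℕ} (hp : InHold γ ξ T t p ω) (hlt : (θ : ℝ) < relStay γ ξ T t ω) :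
    Φ t (θ * t) (kPath γ ξ T ω) = Ψ₁ θ := by
  obtain ⟨s, hs0, hs, hb⟩ := hω.exists_exit ht hp
  rw [hs, NNReal.coe_lt_coe] at hlt
  rw [h.eq_scale ht hθ]
  refine h.const θ hθ p.1 _ fun r hr => ?_
  refine hω.kPath_eq_of_mem hγ hp (le_mul_of_one_le_right' hr.1) ?_
  rw [← hb, ENNReal.coe_lt_coe]
  exact mul_lt_mul_of_pos_left (hr.2.trans_lt (by gcongr)) ht

theorem IsTwoTimeObservable.eq_of_relStay_lt (h : IsTwoTimeObservable Φ Ψ₁ Ξ Ψ₂)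
    (hω : IsRegularClock γ ξ T ω) (hγ : ∀ x, 0 < γ x) {t θ : ℝ≥0} (ht : 0 < t) (hθ : 0 < θ)
    {p : ℕ+ × ℕ} (hp : InHold γ ξ T t p ω) {s : ℝ≥0} (hs0 : 0 < s)
    (hb : ((t * (1 + s) : ℝ≥0) : ℝ≥0∞) = holdEnd γ ξ T p ω) (hlt : s < θ) :
    Φ t (θ * t) (kPath γ ξ T ω) =
      Ξ θ p.1 s (pathSegment (scalePath t ht (kPath γ ξ T ω)) (1 + s) (θ - s)) := by
  rw [h.eq_scale ht hθ]
  refine h.concat θ s hs0 hlt p.1 _ _ (fun r hr => ?_) (fun r => rfl)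
    (hω.kPath_holdEnd_ne hγ hb p.1)
  refine hω.kPath_eq_of_mem hγ hp (le_mul_of_one_le_right' hr.1) ?_
  rw [← hb, ENNReal.coe_lt_coe]
  exact mul_lt_mul_of_pos_left hr.2 ht

theorem IsTwoTimeObservable.abs_le (h : IsTwoTimeObservable Φ Ψ₁ Ξ Ψ₂)
    (hω : IsRegularClock γ ξ T ω) (hγ : ∀ x, 0 < γ x) {t θ : ℝ≥0} (ht : 0 < t) (hθ : 0 < θ)
    {p q : ℕ+ × ℕ} (hp : InHold γ ξ T t p ω) (hq : InHold γ ξ T (t * (1 + θ)) q ω) {C : ℝ}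
    (hC : ∀ (x : ℕ+) (s : ℝ≥0), 0 < s → s < θ → ∀ η : PathSegment (θ - s), |Ξ θ x s η| ≤ C) :
    |Φ t (θ * t) (kPath γ ξ T ω)| ≤ max C |Ψ₁ θ| := by
  obtain ⟨s, hs0, hs, hb⟩ := hω.exists_exit ht hp
  rcases lt_or_gt_of_ne (hω.relStay_ne hγ ht hp hq) with hlt | hlt
  · rw [hs, NNReal.coe_lt_coe] at hlt
    rw [h.eq_of_relStay_lt hω hγ ht hθ hp hs0 hb hlt]
    exact (hC _ _ hs0 hlt _).trans (le_max_left _ _)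
  · rw [h.eq_of_lt_relStay hω hγ ht hθ hp hlt]
    exact le_max_right _ _

/-- The crude bound for use on the unlikely return event: either the difference vanishes or it
compares two values of `Ξ`. -/
theorem IsTwoTimeObservable.abs_sub_le (h : IsTwoTimeObservable Φ Ψ₁ Ξ Ψ₂)
    (hω : IsRegularClock γ ξ T ω) (hγ : ∀ x, 0 < γ x) {t θ : ℝ≥0} (ht : 0 < t) (hθ : 0 < θ)
    {p q : ℕ+ × ℕ} (hp : InHold γ ξ T t p ω) (hq : InHold γ ξ T (t * (1 + θ)) q ω) {C : ℝ}
    (hC : ∀ (x : ℕ+) (s : ℝ≥0), 0 < s → s < θ → ∀ η : PathSegment (θ - s), |Ξ θ x s η| ≤ C) :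
    |Φ t (θ * t) (kPath γ ξ T ω) - if (θ : ℝ) < relStay γ ξ T t ω then Ψ₁ θ
      else Ψ₂ (relStay γ ξ T t ω) θ| ≤ 2 * |C| := by
  obtain ⟨s, hs0, hs, hb⟩ := hω.exists_exit ht hp
  rcases lt_or_gt_of_ne (hω.relStay_ne hγ ht hp hq) with hlt | hlt
  · rw [if_neg hlt.not_gt]
    rw [hs] at hlt ⊢
    rw [NNReal.coe_lt_coe] at hlt
    rw [h.eq_of_relStay_lt hω hγ ht hθ hp hs0 hb hlt, h.psi_two θ s hs0 hlt p.1]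
    refine (abs_sub _ _).trans ?_
    have h1 := hC p.1 s hs0 hlt
      (pathSegment (scalePath t ht (kPath γ ξ T ω)) (1 + s) (θ - s))
    have h2 := hC p.1 s hs0 hlt (constPath OnePoint.infty)
    linarith [le_abs_self C]
  · rw [if_pos hlt, h.eq_of_lt_relStay hω hγ ht hθ hp hlt, sub_self, abs_zero]
    positivity

theorem IsTwoTimeObservable.abs_sub_le_of_no_return (h : IsTwoTimeObservable Φ Ψ₁ Ξ Ψ₂)
    (hω : IsRegularClock γ ξ T ω) (hγ : ∀ x, 0 < γ x) {t θ : ℝ≥0} (ht : 0 < t) (hθ : 0 < θ)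
    {p q : ℕ+ × ℕ} (hp : InHold γ ξ T t p ω) (hq : InHold γ ξ T (t * (1 + θ)) q ω) {ε : ℝ}
    (hε : 0 ≤ ε) {K : ℕ+}
    (hcont : ∀ s : ℝ≥0, 0 < s → s < θ → ∀ η : PathSegment (θ - s),
      (∀ r, NBar.d (η.1 r) OnePoint.infty ≤ ((K : ℕ) : ℝ)⁻¹) →
        |Ξ θ 1 s η - Ξ θ 1 s (constPath OnePoint.infty)| ≤ ε)
    (hret : ¬ holdStart γ ξ T (p.1, p.2 + 1) ω ≤ (t * (1 + θ) : ℝ≥0))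
    (hvis : ∀ x ≤ K, ¬ holdStart γ ξ T (x, 0) ω ≤ (t * (1 + θ) : ℝ≥0)) :
    |Φ t (θ * t) (kPath γ ξ T ω) - if (θ : ℝ) < relStay γ ξ T t ω then Ψ₁ θ
      else Ψ₂ (relStay γ ξ T t ω) θ| ≤ ε := by
  obtain ⟨s, hs0, hs, hb⟩ := hω.exists_exit ht hp
  rcases lt_or_gt_of_ne (hω.relStay_ne hγ ht hp hq) with hlt | hlt
  swap
  · rwa [if_pos hlt, h.eq_of_lt_relStay hω hγ ht hθ hp hlt, sub_self, abs_zero]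
  rw [if_neg hlt.not_gt]
  rw [hs] at hlt ⊢
  rw [NNReal.coe_lt_coe] at hlt
  rw [h.eq_of_relStay_lt hω hγ ht hθ hp hs0 hb hlt]
  set η := pathSegment (scalePath t ht (kPath γ ξ T ω)) (1 + s) (θ - s) with hη
  have hval : ∀ r, η.1 r = (kPath γ ξ T ω).1 (t * (1 + s + r)) := fun r => rfl
  have hle : ∀ r : Icc (0 : ℝ≥0) (θ - s), t * (1 + s + r) ≤ t * (1 + θ) := by
    intro r
    refine mul_le_mul_of_nonneg_left ?_ bot_le
    have := add_le_add_right r.2.2 (1 + s)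
    rwa [add_assoc 1 s (θ - s), add_tsub_cancel_of_le hlt.le] at this
  have hx : ∀ r, η.1 r ≠ (p.1 : NBar) := by
    intro r hr
    rw [hval, hω.kPath_eq_coe_iff hγ] at hr
    obtain ⟨k, hk⟩ := hr
    -- Visits to the same state up to the present one are over by the exit time, so a visit during
    -- `η` is a return.
    have hpk : p.2 < k := by
      by_contra hcon
      refine absurd (hk.2.trans_le ?_) (lt_irrefl _)
      refine (kClock_mono ((eventTime_lt hω.wait_pos p.1).monotone (not_lt.1 hcon))).trans
        (hb.symm.le.trans ?_)
      rw [ENNReal.coe_le_coe]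
      exact mul_le_mul_of_nonneg_left le_self_add bot_le
    exact hret (((kClockLeft_mono ((eventTime_lt hω.wait_pos p.1).monotone hpk)).trans hk.1).trans
      (by exact_mod_cast hle r))
  have hy : ∀ y ≤ K, ∀ r, η.1 r ≠ (y : NBar) := by
    intro y hy r hr
    rw [hval, hω.kPath_eq_coe_iff hγ] at hr
    obtain ⟨k, hk⟩ := hr
    exact hvis y hy (((kClockLeft_mono ((eventTime_lt hω.wait_pos y).monotone
      (Nat.zero_le k))).trans hk.1).trans (by exact_mod_cast hle r))
  -- Continuity at `∞` is not uniform in the state. Passing from the random state to the unvisited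
  -- state `1` requires only one modulus.
  rw [h.homogeneous θ s hs0 hlt p.1 1 η hx (hy 1 one_le), h.psi_two θ s hs0 hlt 1]
  exact hcont s hs0 hlt η fun r => NBar.d_infty_le fun y hyK => hy y hyK r

end Observable

/-! ### Integration by parts against the distribution of a random variable -/

section ByParts

/-- For `S < θ` this is the fundamental theorem of calculus on `(0, S)`; for `S > θ` the integrand
vanishes. The right side is affine in indicators `1{r < S}`, so its mean involves only tails. -/
theorem eq_add_integral_deriv {f : ℝ → ℝ} {θ f₀ S : ℝ} (hθ : 0 < θ) (hS : 0 < S) (hne : S ≠ θ)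
    (h0 : Tendsto f (𝓝[>] 0) (𝓝 f₀))
    (hd : DifferentiableOn ℝ f (Ioo 0 θ)) (hi : IntervalIntegrable (deriv f) volume 0 θ) (c : ℝ) :
    (if θ < S then c else f S) = f₀ + (c - f₀) * (if θ < S then 1 else 0) +
      ∫ r in (0 : ℝ)..θ, deriv f r * ((if r < S then 1 else 0) - (if θ < S then 1 else 0)) := by
  rcases lt_or_gt_of_ne hne with hlt | hlt
  · simp only [if_neg hlt.not_gt, mul_zero, add_zero, sub_zero]
    have hsub : Ioo 0 S ⊆ Ioo 0 θ := Ioo_subset_Ioo_right hlt.le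
    have hderiv : ∀ x ∈ Ioo 0 θ, HasDerivAt f (deriv f x) x := fun x hx =>
      (hd.differentiableAt (isOpen_Ioo.mem_nhds hx)).hasDerivAt
    have hiS : IntervalIntegrable (deriv f) volume 0 S :=
      hi.mono_set (by rw [uIcc_of_le hS.le, uIcc_of_le hθ.le]; exact Icc_subset_Icc_right hlt.le)
    have hcont : Tendsto f (𝓝[<] S) (𝓝 (f S)) :=
      (hderiv S ⟨hS, hlt⟩).continuousAt.tendsto.mono_left nhdsWithin_le_nhds
    have hftc := intervalIntegral.integral_eq_sub_of_hasDerivAt_of_tendsto hS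
      (fun x hx => hderiv x (hsub hx)) hiS h0 hcont
    have hint : ∫ r in (0 : ℝ)..θ, deriv f r * (if r < S then 1 else 0) =
        ∫ r in (0 : ℝ)..S, deriv f r := by
      rw [intervalIntegral.integral_of_le hθ.le, intervalIntegral.integral_of_le hS.le,
        integral_Ioc_eq_integral_Ioo (y := S)]
      have h2 : Ioc 0 θ ∩ Iio S = Ioo 0 S := by
        ext r
        exact ⟨fun hr => ⟨hr.1.1, hr.2⟩, fun hr => ⟨⟨hr.1, (lt_trans hr.2 hlt).le⟩, hr.2⟩⟩
      rw [← h2, ← setIntegral_indicator measurableSet_Iio]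
      refine integral_congr_ae (ae_of_all _ fun r => ?_)
      simp [indicator]
    rw [hint, hftc]
    ring
  · have hz : ∫ r in (0 : ℝ)..θ, deriv f r * ((if r < S then 1 else 0) -
        (if θ < S then 1 else 0)) = 0 := by
      refine intervalIntegral.integral_zero_ae (ae_of_all _ fun r hr => ?_)
      rw [uIoc_of_le hθ.le] at hr
      rw [if_pos hlt, if_pos (hr.2.trans_lt hlt), sub_self, mul_zero]
    rw [hz, if_pos hlt, if_pos hlt]
    ring

variable {Ω : Type*} [MeasurableSpace Ω] {μ : Measure Ω} [IsProbabilityMeasure μ]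

omit [IsProbabilityMeasure μ] in
theorem integral_indicator_lt {S : Ω → ℝ} (hS : Measurable S) (r : ℝ) :
    ∫ ω, (if r < S ω then 1 else 0 : ℝ) ∂μ = μ.real {ω | r < S ω} := by
  rw [← integral_indicator_one (measurableSet_lt measurable_const hS)]
  rfl

theorem integrable_prod_deriv {S : Ω → ℝ} (hS : Measurable S) {g : ℝ → ℝ} {θ : ℝ} (hθ : 0 < θ)
    (hg : IntervalIntegrable g volume 0 θ) :
    Integrable (fun q : Ω × ℝ => g q.2 *
      ((if q.2 < S q.1 then 1 else 0) - (if θ < S q.1 then 1 else 0)))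
      (μ.prod (volume.restrict (Ioc 0 θ))) := by
  have hg' : Integrable (fun q : Ω × ℝ => g q.2) (μ.prod (volume.restrict (Ioc 0 θ))) :=
    ((intervalIntegrable_iff_integrableOn_Ioc_of_le hθ.le).1 hg).comp_snd μ
  refine hg'.mul_bdd (c := 1) ?_ (ae_of_all _ fun q => ?_)
  · refine Measurable.aestronglyMeasurable (Measurable.sub ?_ ?_)
    · exact Measurable.ite (measurableSet_lt measurable_snd (hS.comp measurable_fst))
        measurable_const measurable_const
    · exact Measurable.ite (measurableSet_lt measurable_const (hS.comp measurable_fst))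
        measurable_const measurable_const
  · split_ifs <;> norm_num

theorem integral_by_parts {S : Ω → ℝ} (hS : Measurable S) {g : ℝ → ℝ} {θ : ℝ} (hθ : 0 < θ)
    (hg : IntervalIntegrable g volume 0 θ) (a b : ℝ) :
    ∫ ω, (a + b * (if θ < S ω then 1 else 0) + ∫ r in (0 : ℝ)..θ, g r *
      ((if r < S ω then 1 else 0) - (if θ < S ω then 1 else 0))) ∂μ =
    a + b * μ.real {ω | θ < S ω} +
      ∫ r in (0 : ℝ)..θ, g r * (μ.real {ω | r < S ω} - μ.real {ω | θ < S ω}) := by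
  have hind : ∀ r : ℝ, Integrable (fun ω => (if r < S ω then 1 else 0 : ℝ)) μ := fun r =>
    (integrable_const (1 : ℝ)).indicator (measurableSet_lt measurable_const hS)
  have hprod := integrable_prod_deriv (μ := μ) hS hθ hg
  simp only [intervalIntegral.integral_of_le hθ.le]
  have hfst : Integrable (fun ω => a + b * (if θ < S ω then 1 else 0)) μ :=
    (integrable_const a).add ((hind θ).const_mul b)
  have hsnd : Integrable (fun ω => ∫ r in Ioc 0 θ, g r *
      ((if r < S ω then 1 else 0) - (if θ < S ω then 1 else 0))) μ := hprod.integral_prod_left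
  rw [integral_add hfst hsnd, integral_add (integrable_const a) ((hind θ).const_mul b),
    integral_const, integral_const_mul, integral_indicator_lt hS, integral_integral_swap hprod]
  simp only [probReal_univ, one_smul]
  congr 1
  refine integral_congr_ae (ae_of_all _ fun r => ?_)
  simp only
  rw [integral_const_mul, integral_sub (hind r) (hind θ), integral_indicator_lt hS,
    integral_indicator_lt hS]

theorem aestronglyMeasurable_measureReal_lt {S : Ω → ℝ} {ν : Measure ℝ} :
    AEStronglyMeasurable (fun r => μ.real {ω | r < S ω}) ν := by
  have : Antitone fun r => μ.real {ω | r < S ω} := fun r r' hrr' =>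
    measureReal_mono fun ω (hω : r' < S ω) => hrr'.trans_lt hω
  exact this.measurable.aestronglyMeasurable

/-- Tails are at most one, so `|g|` dominates. Measurability and integrability of `g * Λ` come from
the same pointwise limit. -/
theorem tendsto_integral_mul_tail {ι : Type*} {l : Filter ι} [l.IsCountablyGenerated] [l.NeBot]
    {S : ι → Ω → ℝ} {Λ : ℝ → ℝ} {θ : ℝ} (hθ : 0 < θ)
    (hΛ : ∀ r, 0 < r → Tendsto (fun i => μ.real {ω | r < S i ω}) l (𝓝 (Λ r)))
    {g : ℝ → ℝ} (hg : IntervalIntegrable g volume 0 θ) :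
    IntervalIntegrable (fun r => g r * Λ r) volume 0 θ ∧
      Tendsto (fun i => ∫ r in (0 : ℝ)..θ, g r * (μ.real {ω | r < S i ω} - μ.real {ω | θ < S i ω}))
        l (𝓝 ((∫ r in (0 : ℝ)..θ, g r * Λ r) - (∫ r in (0 : ℝ)..θ, g r) * Λ θ)) := by
  have hgI := (intervalIntegrable_iff_integrableOn_Ioc_of_le hθ.le).1 hg
  have hbd : ∀ (s : Set Ω), ‖μ.real s‖ ≤ 1 := fun s => by
    rw [Real.norm_of_nonneg measureReal_nonneg]
    exact measureReal_le_one
  have hmeas : ∀ i, AEStronglyMeasurable (fun r => g r * μ.real {ω | r < S i ω})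
      (volume.restrict (Ioc 0 θ)) := fun i =>
    hgI.aestronglyMeasurable.mul aestronglyMeasurable_measureReal_lt
  have hlim : ∀ᵐ r ∂volume.restrict (Ioc 0 θ),
      Tendsto (fun i => g r * μ.real {ω | r < S i ω}) l (𝓝 (g r * Λ r)) := by
    filter_upwards [ae_restrict_mem measurableSet_Ioc] with r hr
    exact (hΛ r hr.1).const_mul _
  have hbound : ∀ i r, ‖g r * μ.real {ω | r < S i ω}‖ ≤ ‖g r‖ := fun i r => by
    rw [norm_mul]
    exact mul_le_of_le_one_right (norm_nonneg _) (hbd _)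
  have hint : IntegrableOn (fun r => g r * Λ r) (Ioc 0 θ) := by
    refine hgI.norm.mono' (aestronglyMeasurable_of_tendsto_ae l hmeas hlim) ?_
    filter_upwards [hlim] with r hr
    exact le_of_tendsto' hr.norm fun i => hbound i r
  refine ⟨(intervalIntegrable_iff_integrableOn_Ioc_of_le hθ.le).2 hint, ?_⟩
  have hdct := tendsto_integral_filter_of_dominated_convergence (μ := volume.restrict (Ioc 0 θ))
    (l := l) (fun r => ‖g r‖) (Eventually.of_forall hmeas)
    (Eventually.of_forall fun i => ae_of_all _ (hbound i)) hgI.norm hlim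
  have hsplit : ∀ i, ∫ r in (0 : ℝ)..θ, g r * (μ.real {ω | r < S i ω} - μ.real {ω | θ < S i ω}) =
      (∫ r in Ioc 0 θ, g r * μ.real {ω | r < S i ω}) -
        (∫ r in (0 : ℝ)..θ, g r) * μ.real {ω | θ < S i ω} := by
    intro i
    rw [intervalIntegral.integral_of_le hθ.le, intervalIntegral.integral_of_le hθ.le,
      ← integral_mul_const, ← integral_sub (hgI.norm.mono' (hmeas i) (ae_of_all _ (hbound i)))
      (hgI.mul_const _)]
    simp only [mul_sub]
  simp only [hsplit]
  rw [intervalIntegral.integral_of_le hθ.le (f := fun r => g r * Λ r)]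
  exact hdct.sub ((hΛ θ hθ).const_mul _)

end ByParts

/-! ### The aging limit on the canonical space -/

namespace Config

variable {γ : ℕ+ → ℝ} {Φ : ℝ≥0 → ℝ≥0 → CadlagPath ℝ≥0 → ℝ} {Ψ₁ : ℝ≥0 → ℝ}
  {Ξ : (θ : ℝ≥0) → ℕ+ → (s : ℝ≥0) → PathSegment (θ - s) → ℝ} {Ψ₂ : ℝ → ℝ → ℝ}

theorem aestronglyMeasurable_observable (hγ : ∀ x, 0 < γ x) (hsum : Summable γ)
    (h : IsTwoTimeObservable Φ Ψ₁ Ξ Ψ₂) {t u : ℝ≥0} (ht : 0 < t) (hu : 0 < u) :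
    AEStronglyMeasurable (fun ω => Φ t u (kPath γ wait hold ω)) law :=
  ((h.measurable t u ht hu).comp_aemeasurable (aemeasurable_kPath measurable_wait measurable_hold hγ
    ((ae_isRegularClock hγ hsum).mono fun _ hω => hω.toIsTameClock))).aestronglyMeasurable

theorem integrable_observable (hγ : ∀ x, 0 < γ x) (hsum : Summable γ)
    (h : IsTwoTimeObservable Φ Ψ₁ Ξ Ψ₂) {t θ : ℝ≥0} (ht : 0 < t) (hθ : 0 < θ) :
    Integrable (fun ω => Φ t (θ * t) (kPath γ wait hold ω)) law := by
  obtain ⟨C, hC⟩ := h.bounded θ hθ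
  refine Integrable.of_bound (aestronglyMeasurable_observable hγ hsum h ht (mul_pos hθ ht))
    (max C |Ψ₁ θ|) ?_
  filter_upwards [ae_isRegularClock hγ hsum, ae_exists_inHold hγ hsum ht,
    ae_exists_inHold hγ hsum (t := t * (1 + θ)) (by positivity)] with ω hω ⟨p, hp⟩ ⟨q, hq⟩
  exact h.abs_le hω hγ ht hθ hp hq hC

theorem integral_phiOne (hγ : ∀ x, 0 < γ x) (hsum : Summable γ) {t : ℝ≥0} (ht : 0 < t) (r : ℝ≥0) :
    ∫ ω, phiOne t (r * t) (kPath γ wait hold ω) ∂law =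
      law.real {ω | (r : ℝ) < relStay γ wait hold t ω} := by
  rw [← integral_indicator_lt (measurable_relStay measurable_wait measurable_hold t)]
  refine integral_congr_ae ?_
  filter_upwards [ae_isRegularClock hγ hsum, ae_exists_inHold hγ hsum ht] with ω hω ⟨p, hp⟩
  exact hω.phiOne_eq hγ ht hp r

/-- The observable is close to a function of the remaining holding time alone. -/
theorem tendsto_integral_sub (hγ : ∀ x, 0 < γ x) (hsum : Summable γ)
    (h : IsTwoTimeObservable Φ Ψ₁ Ξ Ψ₂) {θ : ℝ≥0} (hθ : 0 < θ) :
    Tendsto (fun t : ℝ≥0 => ∫ ω, (Φ t (θ * t) (kPath γ wait hold ω) -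
      if (θ : ℝ) < relStay γ wait hold t ω then Ψ₁ θ else Ψ₂ (relStay γ wait hold t ω) θ) ∂law)
      (𝓝[>] 0) (𝓝 0) := by
  obtain ⟨C, hC⟩ := h.bounded θ hθ
  rw [Metric.tendsto_nhds]
  intro ε hε
  obtain ⟨δ, hδ, hcont⟩ := h.continuous_infty θ hθ 1 (ε / 2) (half_pos hε)
  -- States beyond `K = n + 1` are within `1 / K < δ` of `∞`.
  obtain ⟨n, hn⟩ := exists_nat_one_div_lt hδ
  set K : ℕ+ := n.succPNat with hK
  have hKδ : ((K : ℕ) : ℝ)⁻¹ ≤ δ := by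
    rw [hK, Nat.succPNat_coe, Nat.succ_eq_add_one, Nat.cast_add_one, inv_eq_one_div]
    exact hn.le
  have hret := tendsto_measure_returnEvent hγ hsum (1 + θ) K
  have hret' : Tendsto (fun t : ℝ≥0 => ε / 2 +
      2 * |C| * law.real (returnEvent γ t (t * (1 + θ)) K)) (𝓝[>] 0) (𝓝 (ε / 2)) := by
    have := (((ENNReal.tendsto_toReal ENNReal.zero_ne_top).comp hret).const_mul (2 * |C|)).const_add
      (ε / 2)
    simpa [measureReal_def] using this
  filter_upwards [hret'.eventually (gt_mem_nhds (half_lt_self hε)), self_mem_nhdsWithin] with t ht ht0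
  have ht0 : 0 < t := ht0
  rw [dist_zero_right]
  refine lt_of_le_of_lt ?_ ht
  set R := returnEvent γ t (t * (1 + θ)) K with hR
  have hRm : MeasurableSet R := measurableSet_returnEvent _ _ _
  have hind : Integrable (R.indicator (1 : Config → ℝ)) law :=
    (integrable_const (1 : ℝ)).indicator hRm
  have hbound : Integrable (fun ω => ε / 2 + 2 * |C| * R.indicator 1 ω) law :=
    (integrable_const _).add (hind.const_mul _)
  have hbint : ∫ ω, (ε / 2 + 2 * |C| * R.indicator 1 ω) ∂law = ε / 2 + 2 * |C| * law.real R := by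
    rw [integral_add (integrable_const _) (hind.const_mul _),
      integral_const_mul, integral_indicator_one hRm, integral_const, probReal_univ, one_smul]
  rw [← hbint]
  refine norm_integral_le_of_norm_le hbound ?_
  filter_upwards [ae_isRegularClock hγ hsum, ae_exists_inHold hγ hsum ht0,
    ae_exists_inHold hγ hsum (t := t * (1 + θ)) (by positivity)] with ω hω ⟨p, hp⟩ ⟨q, hq⟩
  rw [Real.norm_eq_abs]
  by_cases hωR : ω ∈ R
  · rw [indicator_of_mem hωR]
    refine (h.abs_sub_le hω hγ ht0 hθ hp hq hC).trans ?_
    simp only [Pi.one_apply, mul_one]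
    linarith
  · rw [indicator_of_notMem hωR, mul_zero, add_zero]
    rw [hR, returnEvent, mem_union, not_or] at hωR
    refine h.abs_sub_le_of_no_return hω hγ ht0 hθ hp hq (half_pos hε).le
      (fun s hs0 hs η hη => hcont s hs0 hs η fun r => (hη r).trans hKδ)
      (fun hr => hωR.1 ⟨p, hp, hr⟩) fun x hx hr => hωR.2 (mem_iUnion₂.2 ⟨x, hx, hr⟩)

theorem tendsto_integral_observable (hγ : ∀ x, 0 < γ x) (hsum : Summable γ) {Λ : ℝ → ℝ}
    (hΛ : ∀ θ : ℝ≥0, 0 < θ → Tendsto (fun t : ℝ≥0 =>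
      ∫ ω, phiOne t (θ * t) (kPath γ wait hold ω) ∂law) (𝓝[>] 0) (𝓝 (Λ θ)))
    (h : IsTwoTimeObservable Φ Ψ₁ Ξ Ψ₂) {θ : ℝ≥0} (hθ : 0 < θ) :
    IntervalIntegrable (fun s : ℝ => deriv (fun u : ℝ => Ψ₂ u θ) s * Λ s) volume 0 (θ : ℝ) ∧
    Tendsto (fun t : ℝ≥0 => ∫ ω, Φ t (θ * t) (kPath γ wait hold ω) ∂law) (𝓝[>] 0)
      (𝓝 (Ψ₂ 0 θ + (Ψ₁ θ - Ψ₂ θ θ) * Λ θ +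
        ∫ s in (0 : ℝ)..(θ : ℝ), deriv (fun u : ℝ => Ψ₂ u θ) s * Λ s)) := by
  have hθ' : (0 : ℝ) < θ := hθ
  set S : ℝ≥0 → Config → ℝ := relStay γ wait hold with hSdef
  have hS : ∀ t, Measurable (S t) := measurable_relStay measurable_wait measurable_hold
  set g : ℝ → ℝ := deriv fun u : ℝ => Ψ₂ u θ with hg
  have hgi : IntervalIntegrable g volume 0 θ := h.psi_two_deriv_integrable θ hθ
  have htail : ∀ r : ℝ, 0 < r →
      Tendsto (fun t : ℝ≥0 => law.real {ω | r < S t ω}) (𝓝[>] 0) (𝓝 (Λ r)) := by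
    intro r hr
    lift r to ℝ≥0 using hr.le
    refine (hΛ r hr).congr' ?_
    filter_upwards [self_mem_nhdsWithin] with t ht
    exact integral_phiOne hγ hsum ht r
  obtain ⟨hint, hlim⟩ := tendsto_integral_mul_tail hθ' htail hgi
  refine ⟨hint, ?_⟩
  -- This turns the coefficient `Ψ₁ θ - Ψ₂ 0 θ` of `Λ θ` into `Ψ₁ θ - Ψ₂ θ θ`.
  have hftc : ∫ r in (0 : ℝ)..θ, g r = Ψ₂ θ θ - Ψ₂ 0 θ :=
    intervalIntegral.integral_eq_sub_of_hasDerivAt_of_tendsto hθ' (fun x hx =>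
      ((h.psi_two_differentiable θ hθ).differentiableAt (isOpen_Ioo.mem_nhds hx)).hasDerivAt)
      hgi (h.psi_two_zero θ hθ) (h.psi_two_end θ hθ)
  have hmain : ∀ t : ℝ≥0, 0 < t → ∫ ω, Φ t (θ * t) (kPath γ wait hold ω) ∂law =
      (∫ ω, (Φ t (θ * t) (kPath γ wait hold ω) -
        if (θ : ℝ) < S t ω then Ψ₁ θ else Ψ₂ (S t ω) θ) ∂law) +
      (Ψ₂ 0 θ + (Ψ₁ θ - Ψ₂ 0 θ) * law.real {ω | (θ : ℝ) < S t ω} +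
        ∫ r in (0 : ℝ)..θ, g r * (law.real {ω | r < S t ω} - law.real {ω | (θ : ℝ) < S t ω})) := by
    intro t ht
    have hae : ∀ᵐ ω ∂law, (if (θ : ℝ) < S t ω then Ψ₁ θ else Ψ₂ (S t ω) θ) =
        Ψ₂ 0 θ + (Ψ₁ θ - Ψ₂ 0 θ) * (if (θ : ℝ) < S t ω then 1 else 0) +
        ∫ r in (0 : ℝ)..θ, g r *
          ((if r < S t ω then 1 else 0) - (if (θ : ℝ) < S t ω then 1 else 0)) := by
      filter_upwards [ae_isRegularClock hγ hsum, ae_exists_inHold hγ hsum ht,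
        ae_exists_inHold hγ hsum (t := t * (1 + θ)) (by positivity)] with ω hω ⟨p, hp⟩ ⟨q, hq⟩
      obtain ⟨s, hs0, hs, -⟩ := hω.exists_exit ht hp
      exact eq_add_integral_deriv hθ' (by rw [hs]; exact hs0) (hω.relStay_ne hγ ht hp hq)
        (h.psi_two_zero θ hθ) (h.psi_two_differentiable θ hθ) hgi _
    have hGint : Integrable (fun ω => if (θ : ℝ) < S t ω then Ψ₁ θ else Ψ₂ (S t ω) θ) law := by
      refine Integrable.congr ?_ (hae.mono fun ω hω => hω.symm)
      have h1 : Integrable (fun ω => Ψ₂ 0 θ + (Ψ₁ θ - Ψ₂ 0 θ) *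
          (if (θ : ℝ) < S t ω then 1 else 0)) law :=
        (integrable_const _).add (((integrable_const (1 : ℝ)).indicator
          (measurableSet_lt measurable_const (hS t))).const_mul _)
      refine h1.add ?_
      simp only [intervalIntegral.integral_of_le hθ'.le]
      exact (integrable_prod_deriv (hS t) hθ' hgi).integral_prod_left
    rw [← integral_by_parts (hS t) hθ' hgi, ← integral_congr_ae hae,
      integral_sub (integrable_observable hγ hsum h ht hθ) hGint, sub_add_cancel]
  have hfinal := (tendsto_integral_sub hγ hsum h hθ).add
    ((((htail θ hθ').const_mul (Ψ₁ θ - Ψ₂ 0 θ)).const_add (Ψ₂ 0 θ)).add hlim)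
  have hval : 0 + (Ψ₂ 0 θ + (Ψ₁ θ - Ψ₂ 0 θ) * Λ θ +
      ((∫ r in (0 : ℝ)..θ, g r * Λ r) - (∫ r in (0 : ℝ)..θ, g r) * Λ θ)) =
      Ψ₂ 0 θ + (Ψ₁ θ - Ψ₂ θ θ) * Λ θ + ∫ s in (0 : ℝ)..(θ : ℝ), g s * Λ s := by
    rw [hftc]
    ring
  rw [← hval]
  refine hfinal.congr' ?_
  filter_upwards [self_mem_nhdsWithin] with t ht
  exact (hmain t ht).symm

end Config

/-! ### The two standard observables -/

theorem measurable_eval (t : ℝ≥0) : Measurable fun ζ : CadlagPath ℝ≥0 => ζ.1 t :=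
  (measurable_pi_apply t).comp measurable_subtype_coe

theorem measurableSet_eval_eq (s t : ℝ≥0) : MeasurableSet {ζ : CadlagPath ℝ≥0 | ζ.1 s = ζ.1 t} :=
  measurableSet_eq_fun (measurable_eval s) (measurable_eval t)

/-- Right continuity extends equality from rational times to all times before `u`; the endpoint `u`
is not reached from the right within the interval and is listed separately. This makes `phiOne`
measurable. -/
theorem forall_mem_Icc_eq_iff {t u : ℝ≥0} (htu : t ≤ u) (ζ : CadlagPath ℝ≥0) :
    (∀ s ∈ Icc t u, ζ.1 s = ζ.1 t) ↔
      ζ.1 u = ζ.1 t ∧ ∀ q : ℚ, t ≤ Real.toNNReal q → Real.toNNReal q ≤ u →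
        ζ.1 (Real.toNNReal q) = ζ.1 t := by
  refine ⟨fun h => ⟨h u ⟨htu, le_rfl⟩, fun q h1 h2 => h _ ⟨h1, h2⟩⟩, fun ⟨hu, hq⟩ s hs => ?_⟩
  rcases hs.2.eq_or_lt with rfl | hsu
  · exact hu
  have hfreq : ∃ᶠ r in 𝓝[≥] s, ζ.1 r = ζ.1 t := by
    have hgt : ∃ᶠ r in 𝓝[>] s, ζ.1 r = ζ.1 t := by
      refine (nhdsGT_basis_of_exists_gt ⟨u, hsu⟩).frequently_iff.2 fun v hv => ?_
      have hlt : (s : ℝ) < min v u := NNReal.coe_lt_coe.2 (lt_min hv hsu)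
      obtain ⟨q, h1, h2⟩ := exists_rat_btwn hlt
      have hq1 : s < Real.toNNReal q := Real.lt_toNNReal_iff_coe_lt.2 h1
      have hq2 : Real.toNNReal q < min v u := (Real.toNNReal_lt_iff_lt_coe (s.2.trans h1.le)).2 h2
      exact ⟨_, ⟨hq1, hq2.trans_le (min_le_left _ _)⟩,
        hq q (hs.1.trans hq1.le) (hq2.trans_le (min_le_right _ _)).le⟩
    exact hgt.filter_mono (nhdsWithin_mono s Ioi_subset_Ici_self)
  by_contra hne
  have hopen : ∀ᶠ r in 𝓝[≥] s, ζ.1 r ≠ ζ.1 t :=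
    (ζ.2 s).1.eventually (isOpen_ne.mem_nhds hne)
  exact hfreq hopen

theorem measurable_phiOne (t u : ℝ≥0) : Measurable (phiOne t u) := by
  unfold phiOne
  refine Measurable.ite ?_ measurable_const measurable_const
  have : {ζ : CadlagPath ℝ≥0 | ∀ s ∈ Icc t (t + u), ζ.1 s = ζ.1 t} = {ζ | ζ.1 (t + u) = ζ.1 t} ∩
      ⋂ q : ℚ, ⋂ (_ : t ≤ Real.toNNReal q), ⋂ (_ : Real.toNNReal q ≤ t + u),
        {ζ | ζ.1 (Real.toNNReal q) = ζ.1 t} := by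
    ext ζ
    simp only [mem_inter_iff, mem_iInter]
    exact forall_mem_Icc_eq_iff le_self_add ζ
  rw [this]
  exact (measurableSet_eval_eq _ _).inter (MeasurableSet.iInter fun q => MeasurableSet.iInter
    fun _ => MeasurableSet.iInter fun _ => measurableSet_eval_eq _ _)

theorem measurable_phiTwo (t u : ℝ≥0) : Measurable (phiTwo t u) :=
  Measurable.ite (measurableSet_eval_eq _ _) measurable_const measurable_const

theorem isTwoTimeObservable_phiOne :
    IsTwoTimeObservable phiOne (fun _ => 1) (fun _ _ _ _ => 0) (fun _ _ => 0) where
  measurable t u _ _ := measurable_phiOne t u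
  depends t u _ _ ζ ζ' h := by
    classical
    refine if_congr (forall₂_congr fun s hs => ?_) rfl rfl
    rw [h s hs, h t ⟨le_rfl, le_self_add⟩]
  scaling t u ht _ ζ := by
    classical
    refine if_congr ⟨fun h s hs => ?_, fun h s hs => ?_⟩ rfl rfl
    · change ζ.1 (t * s) = ζ.1 (t * 1)
      rw [mul_one]
      refine h _ ⟨le_mul_of_one_le_right' hs.1, ?_⟩
      calc t * s ≤ t * (1 + u / t) := by gcongr; exact hs.2
        _ = t + u := by rw [mul_add, mul_one, mul_div_cancel₀ _ ht.ne']
    · have h1 := h (s / t) ⟨(one_le_div ht).2 hs.1, ?_⟩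
      · change ζ.1 (t * (s / t)) = ζ.1 (t * 1) at h1
        rwa [mul_one, mul_div_cancel₀ _ ht.ne'] at h1
      · rw [div_le_iff₀ ht, add_mul, one_mul, div_mul_cancel₀ _ ht.ne']
        exact hs.2
  const θ _ x ζ h := by
    classical
    refine if_pos fun s hs => ?_
    rw [h s hs, h 1 ⟨le_rfl, le_self_add⟩]
  concat θ s hs0 hs x ζ η h _ hne := by
    classical
    refine if_neg fun hall => hne ?_
    rw [hall (1 + s) ⟨le_self_add, by gcongr⟩, h 1 ⟨le_rfl, lt_add_of_pos_right _ hs0⟩]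
  bounded θ _ := ⟨0, by simp⟩
  homogeneous _ _ _ _ _ _ _ _ _ := rfl
  continuous_infty θ _ x ε hε := ⟨1, one_pos, fun _ _ _ _ _ => by simpa using hε.le⟩
  psi_two _ _ _ _ _ := rfl
  psi_two_zero _ _ := tendsto_const_nhds
  psi_two_end _ _ := tendsto_const_nhds
  psi_two_differentiable _ _ := differentiableOn_const _
  psi_two_deriv_integrable _ _ := by simp

open Classical in
/-- The indicator that a segment of a path ends at the state `x`. -/
noncomputable def endsAt (θ : ℝ≥0) (x : ℕ+) (s : ℝ≥0) (η : PathSegment (θ - s)) : ℝ :=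
  if η.1 ⟨θ - s, right_mem_Icc.2 bot_le⟩ = (x : NBar) then 1 else 0

theorem endsAt_of_ne {θ : ℝ≥0} {x : ℕ+} {s : ℝ≥0} {η : PathSegment (θ - s)}
    (h : ∀ r, η.1 r ≠ (x : NBar)) : endsAt θ x s η = 0 :=
  if_neg (h _)

theorem endsAt_constPath_infty (θ : ℝ≥0) (x : ℕ+) (s : ℝ≥0) :
    endsAt θ x s (constPath OnePoint.infty) = 0 :=
  endsAt_of_ne fun _ => OnePoint.infty_ne_coe x

theorem isTwoTimeObservable_phiTwo :
    IsTwoTimeObservable phiTwo (fun _ => 1) endsAt (fun _ _ => 0) where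
  measurable t u _ _ := measurable_phiTwo t u
  depends t u _ _ ζ ζ' h := by
    unfold phiTwo
    rw [h t ⟨le_rfl, le_self_add⟩, h (t + u) ⟨le_self_add, le_rfl⟩]
  scaling t u ht _ ζ := by
    have h1 : (scalePath t ht ζ).1 1 = ζ.1 t := congrArg ζ.1 (mul_one t)
    have h2 : (scalePath t ht ζ).1 (1 + u / t) = ζ.1 (t + u) :=
      congrArg ζ.1 (by rw [mul_add, mul_one, mul_div_cancel₀ _ ht.ne'])
    unfold phiTwo
    rw [h1, h2]
  const θ _ x ζ h := by
    refine if_pos ?_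
    rw [h 1 ⟨le_rfl, le_self_add⟩, h (1 + θ) ⟨le_self_add, le_rfl⟩]
  concat θ s hs0 hs x ζ η h hη hne := by
    classical
    have h1 := hη ⟨θ - s, right_mem_Icc.2 bot_le⟩
    rw [add_assoc, add_tsub_cancel_of_le hs.le] at h1
    unfold phiTwo endsAt
    rw [h 1 ⟨le_rfl, lt_add_of_pos_right _ hs0⟩, h1]
    exact if_congr eq_comm rfl rfl
  bounded θ _ := ⟨1, fun x s _ _ η => by unfold endsAt; split_ifs <;> simp⟩
  homogeneous θ s _ _ x y η hx hy := by
    rw [endsAt_of_ne hx, endsAt_of_ne hy]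
  continuous_infty θ _ x ε hε := by
    have hx : (0 : ℝ) < (x : ℕ) := by exact_mod_cast x.pos
    -- The state `x` is at distance `1/x` from `∞`, so a segment within half of that never visits
    -- it.
    refine ⟨((x : ℕ) : ℝ)⁻¹ / 2, by positivity, fun s _ _ η hη => ?_⟩
    have h1 : ∀ r, η.1 r ≠ (x : NBar) := by
      intro r h1
      have h2 := hη r
      rw [h1] at h2
      change |((x : ℕ) : ℝ)⁻¹ - 0| ≤ _ at h2
      rw [sub_zero, abs_of_pos (inv_pos.2 hx)] at h2
      linarith [inv_pos.2 hx]
    rw [endsAt_of_ne h1, endsAt_constPath_infty]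
    simpa using hε.le
  psi_two θ s _ _ x := (endsAt_constPath_infty θ x s).symm
  psi_two_zero _ _ := tendsto_const_nhds
  psi_two_end _ _ := tendsto_const_nhds
  psi_two_differentiable _ _ := differentiableOn_const _
  psi_two_deriv_integrable _ _ := by simp

/-! ### Transfer to an arbitrary probability space -/

section Transfer

variable {Ω : Type*} [MeasurableSpace Ω] {P : Measure Ω}
  {ξ T : ℕ+ → ℕ → Ω → ℝ}

/-- The realization of the driving variables. -/
def drivingConfig (ξ T : ℕ+ → ℕ → Ω → ℝ) (ω : Ω) : Config :=
  Sum.elim (fun p => ξ p.1 p.2 ω) (fun p => T p.1 p.2 ω)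

theorem IsKDriving.hasLaw (h : IsKDriving P ξ T) :
    HasLaw (drivingConfig ξ T) Config.law P := by
  set X : (ℕ+ × ℕ) ⊕ (ℕ+ × ℕ) → Ω → ℝ :=
    Sum.elim (fun p : ℕ+ × ℕ => ξ p.1 p.2) (fun p : ℕ+ × ℕ => T p.1 p.2)
  have hX : ∀ i, HasLaw (X i) (expMeasure 1) P := by
    rintro (p | p)
    · exact h.law_wait p.1 p.2
    · exact h.law_hold p.1 p.2
  have heq : drivingConfig ξ T = fun ω i => X i ω := by
    funext ω i
    rcases i with p | p <;> rfl
  rw [heq]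
  exact ProbabilityTheory.iIndepFun.hasLaw_infinitePi (X := X) (μ := fun _ => expMeasure 1) hX
    h.indep (aemeasurable_pi_iff.2 fun i => (hX i).aemeasurable)

/-- The path built from `ξ, T` at `ω` is by definition the canonical path at `drivingConfig ξ T ω`,
so a change of variables suffices. -/
theorem IsKDriving.integral_kPath (h : IsKDriving P ξ T) (γ : ℕ+ → ℝ) {F : CadlagPath ℝ≥0 → ℝ}
    (hF : AEStronglyMeasurable (fun ω => F (kPath γ Config.wait Config.hold ω)) Config.law) :
    ∫ ω, F (kPath γ ξ T ω) ∂P = ∫ ω, F (kPath γ Config.wait Config.hold ω) ∂Config.law :=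
  h.hasLaw.integral_comp hF

theorem IsKDriving.integrable_kPath (h : IsKDriving P ξ T) (γ : ℕ+ → ℝ) {F : CadlagPath ℝ≥0 → ℝ}
    (hF : Integrable (fun ω => F (kPath γ Config.wait Config.hold ω)) Config.law) :
    Integrable (fun ω => F (kPath γ ξ T ω)) P := by
  rw [← h.hasLaw.map_eq] at hF
  exact hF.comp_aemeasurable h.hasLaw.aemeasurable

end Transfer

theorem corollary5p3 {Ω : Type*} [MeasurableSpace Ω] (P : Measure Ω) [IsProbabilityMeasure P]
    (ξ T : ℕ+ → ℕ → Ω → ℝ) (hdriving : IsKDriving P ξ T)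
    (γ : ℕ+ → ℝ) (hγ_pos : ∀ x, 0 < γ x) (hγ_sum : Summable γ)
    (Λ : ℝ → ℝ)
    (hΛ : ∀ θ : ℝ≥0, 0 < θ →
      Tendsto (fun t : ℝ≥0 => ∫ ω, phiOne t (θ * t) (kPath γ ξ T ω) ∂P) (𝓝[>] 0) (𝓝 (Λ θ))) :
    (∀ (Φ : ℝ≥0 → ℝ≥0 → CadlagPath ℝ≥0 → ℝ) (Ψ₁ : ℝ≥0 → ℝ)
        (Ξ : (θ : ℝ≥0) → ℕ+ → (s : ℝ≥0) → PathSegment (θ - s) → ℝ) (Ψ₂ : ℝ → ℝ → ℝ),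
      IsTwoTimeObservable Φ Ψ₁ Ξ Ψ₂ → ∀ θ : ℝ≥0, 0 < θ →
        (∀ t : ℝ≥0, 0 < t → Integrable (fun ω => Φ t (θ * t) (kPath γ ξ T ω)) P) ∧
        IntervalIntegrable (fun s : ℝ => deriv (fun u : ℝ => Ψ₂ u θ) s * Λ s) volume 0 (θ : ℝ) ∧
        Tendsto (fun t : ℝ≥0 => ∫ ω, Φ t (θ * t) (kPath γ ξ T ω) ∂P) (𝓝[>] 0)
          (𝓝 (Ψ₂ 0 θ + (Ψ₁ θ - Ψ₂ θ θ) * Λ θ +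
            ∫ s in (0 : ℝ)..(θ : ℝ), deriv (fun u : ℝ => Ψ₂ u θ) s * Λ s))) ∧
    (∃ Ξ, IsTwoTimeObservable phiOne (fun _ => 1) Ξ (fun _ _ => 0)) ∧
    (∃ Ξ, IsTwoTimeObservable phiTwo (fun _ => 1) Ξ (fun _ _ => 0)) ∧
    (∀ θ : ℝ≥0, 0 < θ →
      Tendsto (fun t : ℝ≥0 => ∫ ω, phiOne t (θ * t) (kPath γ ξ T ω) ∂P) (𝓝[>] 0) (𝓝 (Λ θ)) ∧
      Tendsto (fun t : ℝ≥0 => ∫ ω, phiTwo t (θ * t) (kPath γ ξ T ω) ∂P) (𝓝[>] 0) (𝓝 (Λ θ))) := by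
  have htransfer : ∀ (Φ : ℝ≥0 → ℝ≥0 → CadlagPath ℝ≥0 → ℝ) (Ψ₁ : ℝ≥0 → ℝ)
      (Ξ : (θ : ℝ≥0) → ℕ+ → (s : ℝ≥0) → PathSegment (θ - s) → ℝ) (Ψ₂ : ℝ → ℝ → ℝ),
      IsTwoTimeObservable Φ Ψ₁ Ξ Ψ₂ → ∀ θ : ℝ≥0, 0 < θ → ∀ t : ℝ≥0, 0 < t →
        ∫ ω, Φ t (θ * t) (kPath γ ξ T ω) ∂P =
          ∫ ω, Φ t (θ * t) (kPath γ Config.wait Config.hold ω) ∂Config.law :=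
    fun Φ Ψ₁ Ξ Ψ₂ h θ hθ t ht => hdriving.integral_kPath γ
      (Config.aestronglyMeasurable_observable hγ_pos hγ_sum h ht (mul_pos hθ ht))
  have hΛ' : ∀ θ : ℝ≥0, 0 < θ → Tendsto (fun t : ℝ≥0 =>
      ∫ ω, phiOne t (θ * t) (kPath γ Config.wait Config.hold ω) ∂Config.law)
      (𝓝[>] 0) (𝓝 (Λ θ)) := by
    intro θ hθ
    refine (hΛ θ hθ).congr' ?_
    filter_upwards [self_mem_nhdsWithin] with t ht
    exact htransfer _ _ _ _ isTwoTimeObservable_phiOne θ hθ t ht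
  have hlim : ∀ (Φ : ℝ≥0 → ℝ≥0 → CadlagPath ℝ≥0 → ℝ) (Ψ₁ : ℝ≥0 → ℝ)
      (Ξ : (θ : ℝ≥0) → ℕ+ → (s : ℝ≥0) → PathSegment (θ - s) → ℝ) (Ψ₂ : ℝ → ℝ → ℝ),
      IsTwoTimeObservable Φ Ψ₁ Ξ Ψ₂ → ∀ θ : ℝ≥0, 0 < θ →
        Tendsto (fun t : ℝ≥0 => ∫ ω, Φ t (θ * t) (kPath γ ξ T ω) ∂P) (𝓝[>] 0)
          (𝓝 (Ψ₂ 0 θ + (Ψ₁ θ - Ψ₂ θ θ) * Λ θ +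
            ∫ s in (0 : ℝ)..(θ : ℝ), deriv (fun u : ℝ => Ψ₂ u θ) s * Λ s)) := by
    intro Φ Ψ₁ Ξ Ψ₂ h θ hθ
    refine (Config.tendsto_integral_observable hγ_pos hγ_sum hΛ' h hθ).2.congr' ?_
    filter_upwards [self_mem_nhdsWithin] with t ht
    exact (htransfer Φ Ψ₁ Ξ Ψ₂ h θ hθ t ht).symm
  refine ⟨fun Φ Ψ₁ Ξ Ψ₂ h θ hθ => ⟨fun t ht => hdriving.integrable_kPath γ
    (Config.integrable_observable hγ_pos hγ_sum h ht hθ),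
    (Config.tendsto_integral_observable hγ_pos hγ_sum hΛ' h hθ).1, hlim Φ Ψ₁ Ξ Ψ₂ h θ hθ⟩,
    ⟨_, isTwoTimeObservable_phiOne⟩, ⟨_, isTwoTimeObservable_phiTwo⟩, fun θ hθ => ⟨hΛ θ hθ, ?_⟩⟩
  simpa using hlim _ _ _ _ isTwoTimeObservable_phiTwo θ hθ
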